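/- Hackenbush is played on a finite multigraph with edges colored blue, red or green and a designated set of ground vertices. The players Left and Right alternately cut one edge, Left only a blue or green edge and Right only a red or green edge; after each cut everything no longer connected to the ground is discarded. Under normal play a player who cannot move loses, and under misère play a player who cannot move wins. A winning move of a player is a legal move to a position from which the opponent, moving next, does not win. A Generalized Flower is a Hackenbush graph consisting of a path of $h\ge 1$ green edges (its stem; $h$ is its height) with only its bottom vertex on the ground, together with a finite Hackenbush graph without green edges (its Blossom, possibly empty) whose ground vertices are all identified with the top vertex of the stem. Its blossom value $x$ is the normal-play value of the Blossom, that is, the dyadic rational defined recursively as the simplest one that is greater than the values of all left options and smaller than the values of all right options (simplest: least denominator, and then least absolute value). The Generalized Flower is blue if $x>0$, red if $x<0$, and counts as a Stalk if $x=0$. For Generalized Flowers $F_1,F_2$ with heights $h_1,h_2$ and blossom values $x_1,x_2$, we say that $F_1$ is weaker than $F_2$ if $h_1>h_2$, or $h_1=h_2$ and $|x_1|<|x_2|$. A blue and a red Generalized Flower cancel if $h_1=h_2$ and $|x_1|=|x_2|$. A Generalized Flowerbed of size $n$ is a disjunctive sum (disjoint union) of finitely many Generalized Flowers of which exactly $n$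 are blue and exactly $n$ are red, the others being Stalks. Theorem 4.10. Let $F$ be a Generalized Flowerbed of size $n$ such that some red or blue Generalized Flower in $F$ has height at least $2$, no two Generalized Flowers in $F$ cancel, and the weakest Generalized Flower is red (that is, there is a red Generalized Flower in $F$ such that no red or blue Generalized Flower in $F$ is weaker than it). Then, under normal play and under misère play alike, Left, moving first, has a winning move in $F$. Moreover, if $n\ge 2$, then there is a single move of Left in $F$ that is winning both under normal play and under misère play. -/

import Mathlib

universe u

inductive EdgeColor
  | blue
  | red
  | green

inductive Player
  | left
  | right

inductive PlayConvention
  | normal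
  | misere

def Player.other : Player → Player
  | .left => .right
  | .right => .left

/-- Left may cut blue and green edges, Right may cut red and green edges. -/
def Player.CanCut : Player → EdgeColor → Prop
  | .left, c => c ≠ EdgeColor.red
  | .right, c => c ≠ EdgeColor.blue

/-- A Hackenbush graph: a multigraph (loops and parallel edges allowed) with finitely many edges,
each of them colored, and a designated set of ground vertices. (The vertex type need not be finite:
isolated vertices play no role in the game.) -/
structure Hackenbush where
  V : Type u
  E : Type u
  finite_edges : Finite E
  ends : E → Sym2 V
  color : E → EdgeColor
  ground : Set V

namespace Hackenbush

variable (G : Hackenbush.{u})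

/-- The vertices that are joined to the ground by a path using only edges of `S`. -/
inductive Grounded (S : Set G.E) : G.V → Prop
  | base (v : G.V) : v ∈ G.ground → Grounded S v
  | step (e : G.E) (v w : G.V) : e ∈ S → v ∈ G.ends e → w ∈ G.ends e →
      Grounded S v → Grounded S w

/-- Keep only those edges of `S` that lie in a component of `S` containing a ground vertex. -/
def prune (S : Set G.E) : Set G.E :=
  {e | e ∈ S ∧ ∃ v ∈ G.ends e, G.Grounded S v}

/-- A position in the play on `G` is the set of edges that are still present. This is the initial
position: everything that is connected to the ground. -/
def start : Set G.E := G.prune Set.univ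

/-- Cut the edge `e`, then discard what is no longer connected to the ground. -/
def cut (S : Set G.E) (e : G.E) : Set G.E := G.prune (S \ {e})

/-- `e` is a legal move for the player `p` in the position `S`. -/
def Legal (p : Player) (S : Set G.E) (e : G.E) : Prop :=
  e ∈ S ∧ p.CanCut (G.color e)

theorem ncard_cut_lt {S : Set G.E} {e : G.E} (he : e ∈ S) :
    (G.cut S e).ncard < S.ncard := by
  have := G.finite_edges
  refine Set.ncard_lt_ncard ?_ (Set.toFinite S)
  refine ⟨fun f hf => hf.1.1, fun h => ?_⟩
  exact (h he).1.2 rfl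

/-- The player `p`, who is to move in the position `S`, wins under best play. A player who cannot
move loses under normal play and wins under misere play. -/
def NextWins (c : PlayConvention) (p : Player) (S : Set G.E) : Prop :=
  (c = PlayConvention.misere ∧ ∀ e, ¬ G.Legal p S e) ∨
    ∃ e, ∃ _ : G.Legal p S e, ¬ NextWins c p.other (G.cut S e)
termination_by S.ncard
decreasing_by exact G.ncard_cut_lt (by rename_i h; exact h.1)

/-- Cutting `e` is a winning move for `p` in the position `S`: the move is legal, and the opponent,
who moves next, does not win. -/
def WinningMove (c : PlayConvention) (p : Player) (S : Set G.E) (e : G.E) : Prop :=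
  G.Legal p S e ∧ ¬ G.NextWins c p.other (G.cut S e)

end Hackenbush

/-- `x` is a dyadic rational lying strictly above `A` and strictly below `B`. -/
def IsDyadicBetween (A B : Set ℚ) (x : ℚ) : Prop :=
  (∃ b : ℕ, x.den = 2 ^ b) ∧ (∀ l ∈ A, l < x) ∧ (∀ r ∈ B, x < r)

/-- `x` is the simplest dyadic rational strictly between `A` and `B`: its denominator is minimal,
and among those of minimal denominator its absolute value is minimal (the latter matters only for
integers). There is at most one such number. -/
def IsSimplestBetween (A B : Set ℚ) (x : ℚ) : Prop :=
  IsDyadicBetween A B x ∧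
    ∀ y, IsDyadicBetween A B y → x.den < y.den ∨ (x.den = y.den ∧ |x| ≤ |y|)

open Classical in
/-- The simplest dyadic rational strictly between `A` and `B` (and `0` if there is none, which
does not happen for the sets of option values of a red-blue Hackenbush position). -/
noncomputable def simplestBetween (A B : Set ℚ) : ℚ :=
  if h : ∃ x, IsSimplestBetween A B x then h.choose else 0

namespace Hackenbush

/-- The graph has no green edges. -/
def RedBlue (G : Hackenbush.{u}) : Prop := ∀ e, G.color e ≠ EdgeColor.green

/-- The normal-play value of a position on a red-blue Hackenbush graph: the simplest dyadic rational
above the values of all left options and below the values of all right options. -/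
noncomputable def posValue (G : Hackenbush.{u}) (S : Set G.E) : ℚ :=
  simplestBetween
    {x | ∃ e, ∃ _ : G.Legal Player.left S e, x = posValue G (G.cut S e)}
    {x | ∃ e, ∃ _ : G.Legal Player.right S e, x = posValue G (G.cut S e)}
termination_by S.ncard
decreasing_by all_goals exact G.ncard_cut_lt (by rename_i h; exact h.1)

/-- The normal-play value of a red-blue Hackenbush graph. -/
noncomputable def value (G : Hackenbush.{u}) : ℚ := G.posValue G.start

/-- The disjunctive sum: the disjoint union of the graphs. -/
def sum {ι : Type} [Finite ι] (G : ι → Hackenbush.{u}) : Hackenbush.{u} where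
  V := Σ i, (G i).V
  E := Σ i, (G i).E
  finite_edges := by
    have := fun i => (G i).finite_edges
    infer_instance
  ends := fun e => ((G e.1).ends e.2).map (Sigma.mk e.1)
  color := fun e => (G e.1).color e.2
  ground := {v | v.2 ∈ (G v.1).ground}

open Classical in
/-- A green String of length `h` supporting the graph `B`. The String has the vertices
`0, …, h`, of which `0` is on the ground, and its edge `k` joins `k` to `k + 1`. The ground
vertices of `B` are all identified with the top vertex `h`. -/
noncomputable def onStem (h : ℕ) (B : Hackenbush.{u}) : Hackenbush.{u} where
  V := Fin (h + 1) ⊕ B.V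
  E := Fin h ⊕ B.E
  finite_edges := by
    have := B.finite_edges
    infer_instance
  ends := fun e => match e with
    | .inl k => s(.inl k.castSucc, .inl k.succ)
    | .inr e => (B.ends e).map
        (fun v => if v ∈ B.ground then Sum.inl (Fin.last h) else Sum.inr v)
  color := fun e => match e with
    | .inl _ => EdgeColor.green
    | .inr e => B.color e
  ground := {.inl 0}

end Hackenbush

/-- A Generalized Flower: a green String (the stem) of length `height ≥ 1` supporting a red-blue
Hackenbush graph (the blossom). A Stalk is the case of an empty blossom. -/
structure GenFlower where
  height : ℕ
  height_pos : 1 ≤ height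
  blossom : Hackenbush.{u}
  redBlue : blossom.RedBlue

namespace GenFlower

noncomputable def graph (F : GenFlower.{u}) : Hackenbush.{u} :=
  Hackenbush.onStem F.height F.blossom

noncomputable def blossomValue (F : GenFlower.{u}) : ℚ := F.blossom.value

def IsBlue (F : GenFlower.{u}) : Prop := 0 < F.blossomValue

def IsRed (F : GenFlower.{u}) : Prop := F.blossomValue < 0

/-- `F₁` is weaker than `F₂`. -/
def Weaker (F₁ F₂ : GenFlower.{u}) : Prop :=
  F₂.height < F₁.height ∨
    (F₁.height = F₂.height ∧ |F₁.blossomValue| < |F₂.blossomValue|)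

/-- A blue and a red Generalized Flower of the same height and with opposite blossom values. -/
def Cancel (F₁ F₂ : GenFlower.{u}) : Prop :=
  F₁.IsBlue ∧ F₂.IsRed ∧ F₁.height = F₂.height ∧ F₁.blossomValue = -F₂.blossomValue

end GenFlower

/-- The disjunctive sum of the `F i` is a Generalized Flowerbed of size `n`: exactly `n` of them are
blue and exactly `n` are red. (Those of blossom value `0` are neither; they count as Stalks.) -/
def IsFlowerbed {ι : Type} (F : ι → GenFlower.{u}) (n : ℕ) : Prop :=
  {i | (F i).IsBlue}.ncard = n ∧ {i | (F i).IsRed}.ncard = n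

/-- The Hackenbush graph that is the disjunctive sum of the Generalized Flowers `F i`. -/
noncomputable def flowerSum {ι : Type} [Finite ι] (F : ι → GenFlower.{u}) : Hackenbush.{u} :=
  Hackenbush.sum (fun i => (F i).graph)

/-! For the outcome, a blossom matters only through its value, and monotonically so. A position is
therefore abstracted to stem heights together with blossoms from games whose positions are numbers:
`isSimplestBetween_posValue` shows that red-blue blossoms qualify, and `nextWins_edgeSet` transfers
outcomes. By `wins_mono`, lowering blossom values never helps Left, under either convention, so
blossoms of nonnegative value may be deleted when proving a win for Left. What remains is a few
flowers inside a game of Nim, and `nimComplement` treats both conventions of Nim at once.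

Numbers of flowers decide first. Left wins with one blue flower more than red ones when moving
first, and with two more when moving second (`wins_of_majority`): Left razes red flowers until a
blue flower among Stalks wins (`wins_single`). If there are equally many, at least two of each
color, Left razes a red flower other than the weakest one `f`. Right must now cut a blue stem, since
otherwise Left is on move with a majority. The numbers are then equal again, and `f`, untouched, is
still weaker than every blue flower. This first move does not depend on the convention, which gives
the second claim.

The induction ends with one blue flower and `f`. If `f` is taller, Left shortens it to a Stalk for
which the blue flower wins against Right on move (`wins_left_of_taller_red`). If the heights agree,
the two blossom values have positive sum because nothing cancels; Left keeps this sum nonnegative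
and the Nim sum of the Stalks zero (`wins_left_pair`). Height at least 2 lets Left answer a cut in
one of the two stems even when misère play calls for the other parity. -/

section Dyadic

/-! ### Simplest dyadic rationals -/

theorem exists_dyadic_between {l r : ℚ} (h : l < r) :
    ∃ x : ℚ, (∃ b : ℕ, x.den = 2 ^ b) ∧ l < x ∧ x < r := by
  obtain ⟨n, hn⟩ := pow_unbounded_of_one_lt (1 / (r - l)) (one_lt_two (α := ℚ))
  have h2 : (0 : ℚ) < 2 ^ n := by positivity
  have hrl : 0 < r - l := sub_pos.2 h
  rw [div_lt_iff₀ hrl] at hn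
  -- Scaled by `2 ^ n` the interval is longer than 1, so it contains the first integer above its
  -- left end.
  refine ⟨((⌊l * 2 ^ n⌋ + 1 : ℤ) : ℚ) / ((2 ^ n : ℕ) : ℤ), ?_, ?_, ?_⟩
  · have hd := Rat.den_dvd (⌊l * 2 ^ n⌋ + 1) ((2 ^ n : ℕ) : ℤ)
    exact ((Nat.dvd_prime_pow Nat.prime_two).1 (Int.natCast_dvd_natCast.1 (by rwa [Rat.divInt_eq_div] at hd))).imp fun _ h => h.2
  · push_cast
    rw [lt_div_iff₀ h2]
    exact Int.lt_floor_add_one _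
  · push_cast
    rw [div_lt_iff₀ h2]
    have := Int.floor_le (l * 2 ^ n)
    nlinarith

theorem exists_isDyadicBetween {A B : Set ℚ} (hA : A.Finite) (hB : B.Finite)
    (h : ∀ a ∈ A, ∀ b ∈ B, a < b) : ∃ x, IsDyadicBetween A B x := by
  obtain ⟨m, hm, hm'⟩ := Order.exists_between_finsets hA.toFinset hB.toFinset
    (by simpa using h)
  -- The second point `k` yields an open interval for the dyadic even if `B` is empty.
  obtain ⟨k, hk, hk'⟩ := Order.exists_between_finsets {m} hB.toFinset (by simpa using hm')
  obtain ⟨x, hx, hmx, hxk⟩ := exists_dyadic_between (hk m (by simp))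
  exact ⟨x, hx, fun l hl => (hm l (by simpa using hl)).trans hmx,
    fun r hr => hxk.trans (hk' r (by simpa using hr))⟩

theorem abs_le_abs_of_natAbs_num_le {x y : ℚ} (hd : x.den = y.den)
    (h : x.num.natAbs ≤ y.num.natAbs) : |x| ≤ |y| := by
  rw [← Rat.num_div_den x, ← Rat.num_div_den y, abs_div, abs_div, hd]
  refine div_le_div_of_nonneg_right ?_ (abs_nonneg _)
  rw [← Int.cast_abs, ← Int.cast_abs, Int.abs_eq_natAbs, Int.abs_eq_natAbs]
  exact_mod_cast h

theorem exists_isSimplestBetween {A B : Set ℚ} (h : ∃ x, IsDyadicBetween A B x) :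
    ∃ x, IsSimplestBetween A B x := by
  obtain ⟨x, hx, hmin⟩ := (InvImage.wf Rat.den wellFounded_lt).has_min
    {x | IsDyadicBetween A B x} h
  obtain ⟨y, ⟨hy, hyx⟩, hymin⟩ :=
    (InvImage.wf (fun z : ℚ => z.num.natAbs) wellFounded_lt).has_min
      {z | IsDyadicBetween A B z ∧ z.den = x.den} ⟨x, hx, rfl⟩
  refine ⟨y, hy, fun z hz => ?_⟩
  rcases lt_or_eq_of_le (not_lt.1 (hmin z hz)) with h1 | h1
  · exact .inl (hyx ▸ h1)
  · have hyz : y.den = z.den := hyx.trans h1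
    exact .inr ⟨hyz, abs_le_abs_of_natAbs_num_le hyz (not_lt.1 (hymin z ⟨hz, h1.symm⟩))⟩

theorem simplestBetween_spec {A B : Set ℚ} (h : ∃ x, IsDyadicBetween A B x) :
    IsSimplestBetween A B (simplestBetween A B) := by
  rw [simplestBetween, dif_pos (exists_isSimplestBetween h)]
  exact (exists_isSimplestBetween h).choose_spec

/-- Zero has the least denominator and the least absolute value, so it is chosen wherever it is
allowed. -/
theorem IsSimplestBetween.eq_zero {A B : Set ℚ} {x : ℚ} (h : IsSimplestBetween A B x)
    (hA : ∀ a ∈ A, a < 0) (hB : ∀ b ∈ B, 0 < b) : x = 0 := by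
  rcases h.2 0 ⟨⟨0, rfl⟩, hA, hB⟩ with h | h
  · have := x.den_pos
    simp at h
  · simpa using h.2

/-- Two numbers that both satisfy the constraints of the other have the same absolute value. -/
theorem IsSimplestBetween.abs_eq {A B A' B' : Set ℚ} {x y y' x' : ℚ}
    (hx : IsSimplestBetween A B x) (hy : IsSimplestBetween A' B' y)
    (hx' : IsDyadicBetween A' B' x') (hy' : IsDyadicBetween A B y')
    (hxx : x' = x ∨ x' = -x) (hyy : y' = y ∨ y' = -y) : |x| = |y| := by
  have ex : x'.den = x.den ∧ |x'| = |x| := by rcases hxx with rfl | rfl <;> simp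
  have ey : y'.den = y.den ∧ |y'| = |y| := by rcases hyy with rfl | rfl <;> simp
  have h1 := hx.2 y' hy'
  have h2 := hy.2 x' hx'
  rw [ex.1, ex.2] at h2
  rw [ey.1, ey.2] at h1
  rcases h1 with h1 | h1 <;> rcases h2 with h2 | h2
  · omega
  · omega
  · omega
  · exact le_antisymm h1.2 h2.2

theorem IsDyadicBetween.dyadic_neg {A B : Set ℚ} {x : ℚ} (h : IsDyadicBetween A B x) :
    ∃ b : ℕ, (-x).den = 2 ^ b := by
  simpa using h.1

/-- If `y < x`, then Left can move in `x` or Right can move in `y` without reversing the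
inequality. -/
theorem IsSimplestBetween.exists_option_of_lt {A B A' B' : Set ℚ} {x y : ℚ}
    (hx : IsSimplestBetween A B x) (hy : IsSimplestBetween A' B' y) (h : y < x) :
    (∃ a ∈ A, y ≤ a) ∨ ∃ b ∈ B', b ≤ x := by
  by_contra! hcon
  obtain ⟨h1, h2⟩ := hcon
  have hyx : IsDyadicBetween A B y := ⟨hy.1.1, h1, fun r hr => h.trans (hx.1.2.2 r hr)⟩
  have hxy : IsDyadicBetween A' B' x := ⟨hx.1.1, fun l hl => (hy.1.2.1 l hl).trans h, h2⟩
  -- Each number meets the constraints of the other, so they differ at most in sign; opposite signs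
  -- would make 0 admissible for `x`.
  have habs := hx.abs_eq hy hxy hyx (.inl rfl) (.inl rfl)
  rcases abs_eq_abs.1 habs with e | e
  · exact h.ne' e
  · have hx0 : 0 < x := by linarith
    exact hx0.ne' (hx.eq_zero (fun a ha => by linarith [h1 a ha])
      fun b hb => hx0.trans (hx.1.2.2 b hb))

/-- If `0 < x + y`, then Left can move in `x` or in `y` keeping the sum nonnegative. -/
theorem IsSimplestBetween.exists_option_of_add_pos {A B A' B' : Set ℚ} {x y : ℚ}
    (hx : IsSimplestBetween A B x) (hy : IsSimplestBetween A' B' y) (h : 0 < x + y) :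
    (∃ a ∈ A, 0 ≤ a + y) ∨ ∃ a ∈ A', 0 ≤ x + a := by
  by_contra! hcon
  obtain ⟨h1, h2⟩ := hcon
  -- If every Left move made the sum negative, `-y` would fit the constraints of `x`, and `-x` those
  -- of `y`.
  have hyx : IsDyadicBetween A B (-y) := ⟨hy.1.dyadic_neg, fun l hl => by linarith [h1 l hl],
    fun r hr => by linarith [hx.1.2.2 r hr]⟩
  have hxy : IsDyadicBetween A' B' (-x) := ⟨hx.1.dyadic_neg, fun l hl => by linarith [h2 l hl],
    fun r hr => by linarith [hy.1.2.2 r hr]⟩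
  have habs := hx.abs_eq hy hxy hyx (.inr rfl) (.inr rfl)
  rcases abs_eq_abs.1 habs with e | e
  · have hx0 : 0 < x := by linarith
    exact hx0.ne' (hx.eq_zero (fun a ha => by linarith [h1 a ha])
      fun b hb => hx0.trans (hx.1.2.2 b hb))
  · linarith

end Dyadic

/-! ### Pruning, and red-blue positions as numbers -/

namespace Hackenbush

variable {G : Hackenbush.{u}}

theorem Grounded.mono {S T : Set G.E} (hST : S ⊆ T) {v : G.V} (h : G.Grounded S v) :
    G.Grounded T v := by
  induction h with
  | base v hv => exact .base v hv
  | step e v w he hv hw _ ih => exact .step e v w (hST he) hv hw ih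

theorem prune_subset (S : Set G.E) : G.prune S ⊆ S := fun _ h => h.1

theorem prune_mono {S T : Set G.E} (hST : S ⊆ T) : G.prune S ⊆ G.prune T :=
  fun _ h => ⟨hST h.1, h.2.imp fun _ hv => ⟨hv.1, hv.2.mono hST⟩⟩

theorem grounded_prune_diff {S T : Set G.E} {v : G.V} (h : G.Grounded (S \ T) v) :
    G.Grounded (G.prune S \ T) v := by
  induction h with
  | base v hv => exact .base v hv
  | step e v w he hv hw h ih =>
    exact .step e v w ⟨⟨he.1, v, hv, h.mono Set.sdiff_subset⟩, he.2⟩ hv hw ih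

/-- A path to the ground avoiding `T` uses only edges that pruning `S` keeps. Discarding can thus be
postponed to the end of a series of cuts, which makes cuts commute. -/
theorem prune_prune_diff (S T : Set G.E) : G.prune (G.prune S \ T) = G.prune (S \ T) := by
  refine (prune_mono (Set.sdiff_subset_sdiff_left (prune_subset S))).antisymm fun e he => ?_
  obtain ⟨he, v, hv, hg⟩ := he
  exact ⟨⟨⟨he.1, v, hv, hg.mono Set.sdiff_subset⟩, he.2⟩, v, hv, grounded_prune_diff hg⟩

theorem prune_prune (S : Set G.E) : G.prune (G.prune S) = G.prune S := by
  simpa using prune_prune_diff S ∅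

theorem prune_cut (S : Set G.E) (e : G.E) : G.prune (G.cut S e) = G.cut S e := prune_prune _

theorem prune_empty : G.prune ∅ = ∅ := Set.subset_empty_iff.1 (prune_subset _)

theorem cut_comm (S : Set G.E) (e f : G.E) : G.cut (G.cut S e) f = G.cut (G.cut S f) e := by
  simp only [cut, prune_prune_diff]
  rw [Set.sdiff_sdiff_comm]

theorem cut_of_notMem {S : Set G.E} (hS : G.prune S = S) {e : G.E} (he : e ∉ S) :
    G.cut S e = S := by
  rw [cut, Set.sdiff_singleton_eq_self he, hS]

/-- Of two edges, one can be reached from the ground without using the other. -/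
theorem mem_cut_or_mem_cut {S : Set G.E} (hS : G.prune S = S) {e f : G.E} (he : e ∈ S)
    (hf : f ∈ S) (hef : e ≠ f) : f ∈ G.cut S e ∨ e ∈ G.cut S f := by
  by_contra! hcon
  obtain ⟨h1, h2⟩ := hcon
  have hsub_e : S \ {e, f} ⊆ S \ {e} := fun x hx => ⟨hx.1, fun h => hx.2 (.inl h)⟩
  have hsub_f : S \ {e, f} ⊆ S \ {f} := fun x hx => ⟨hx.1, fun h => hx.2 (.inr h)⟩
  -- If each edge needed the other, no path from the ground could use either: the first of the two
  -- on it would be reached without the other.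
  have key : ∀ v, G.Grounded S v → G.Grounded (S \ {e, f}) v := by
    intro v hv
    induction hv with
    | base v hv => exact .base v hv
    | step g v w hg hv hw _ ih =>
      refine .step g v w ⟨hg, ?_⟩ hv hw ih
      rintro (rfl | rfl)
      · exact h2 ⟨⟨hg, hef⟩, v, hv, ih.mono hsub_f⟩
      · exact h1 ⟨⟨hg, hef.symm⟩, v, hv, ih.mono hsub_e⟩
  rw [← hS] at he
  obtain ⟨he, v, hv, hg⟩ := he
  exact h2 ⟨⟨he, hef⟩, v, hv, (key v hg).mono hsub_f⟩

variable (G) in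
/-- The values of the options of the player `p`. -/
def optionValues (p : Player) (S : Set G.E) : Set ℚ :=
  {x | ∃ e, ∃ _ : G.Legal p S e, x = G.posValue (G.cut S e)}

theorem finite_optionValues (p : Player) (S : Set G.E) : (G.optionValues p S).Finite := by
  have := G.finite_edges
  refine (Set.finite_range fun e => G.posValue (G.cut S e)).subset ?_
  rintro x ⟨e, -, rfl⟩
  exact ⟨e, rfl⟩

theorem posValue_eq (S : Set G.E) :
    G.posValue S = simplestBetween (G.optionValues .left S) (G.optionValues .right S) := by
  rw [posValue]
  rfl

theorem ne_of_legal (hG : G.RedBlue) {S : Set G.E} {e f : G.E} (he : G.Legal .left S e)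
    (hf : G.Legal .right S f) : e ≠ f := by
  rintro rfl
  have h1 : G.color e ≠ .red := he.2
  have h2 : G.color e ≠ .blue := hf.2
  have h3 := hG e
  cases h : G.color e <;> simp_all

/-- The point is that Left options lie below Right options. For a Left edge `e` and a Right edge
`f`, inductively cutting `e` gives less than cutting both, which gives less than cutting `f`. If one
cut already removes the other edge, one of these inequalities becomes an equality, but never both.
-/
theorem isSimplestBetween_posValue (hG : G.RedBlue) {S : Set G.E} (hS : G.prune S = S) :
    IsSimplestBetween (G.optionValues .left S) (G.optionValues .right S) (G.posValue S) := by
  induction hn : S.ncard using Nat.strong_induction_on generalizing S with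
  | _ n ih =>
    rw [posValue_eq]
    refine simplestBetween_spec
      (exists_isDyadicBetween (finite_optionValues _ _) (finite_optionValues _ _) ?_)
    rintro _ ⟨e, he, rfl⟩ _ ⟨f, hf, rfl⟩
    have IHe := ih _ (hn ▸ G.ncard_cut_lt he.1) (prune_cut S e) rfl
    have IHf := ih _ (hn ▸ G.ncard_cut_lt hf.1) (prune_cut S f) rfl
    have h1 : f ∈ G.cut S e → G.posValue (G.cut S e) < G.posValue (G.cut (G.cut S e) f) :=
      fun h => IHe.1.2.2 _ ⟨f, ⟨h, hf.2⟩, rfl⟩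
    have h2 : e ∈ G.cut S f → G.posValue (G.cut (G.cut S f) e) < G.posValue (G.cut S f) :=
      fun h => IHf.1.2.1 _ ⟨e, ⟨h, he.2⟩, rfl⟩
    rw [cut_comm] at h1
    by_cases hfe : f ∈ G.cut S e
    · by_cases hef : e ∈ G.cut S f
      · exact (h1 hfe).trans (h2 hef)
      · have := h1 hfe
        rwa [cut_of_notMem (prune_cut S f) hef] at this
    · have hef := (mem_cut_or_mem_cut hS he.1 hf.1 (ne_of_legal hG he hf)).resolve_left hfe
      have := h2 hef
      rwa [cut_comm, cut_of_notMem (prune_cut S e) hfe] at this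

end Hackenbush

/-! ### Abstract games with number values -/

/-- A game in which every position has a number as its value: Left's moves decrease the value,
Right's moves increase it, and the value is the simplest number that fits. -/
class NumberGame (N : Type*) where
  Move : Player → N → N → Prop
  val : N → ℚ
  size : N → ℕ
  zero : N
  size_lt {p : Player} {a b : N} : Move p a b → size b < size a
  val_isSimplest (a : N) :
    IsSimplestBetween {x | ∃ b, Move .left a b ∧ x = val b} {x | ∃ b, Move .right a b ∧ x = val b}
      (val a)
  not_move_zero {p : Player} {a : N} : ¬ Move p zero a
  size_zero : size zero = 0

namespace NumberGame

variable {N N' : Type*} [NumberGame N] [NumberGame N']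

theorem val_zero : val (zero : N) = 0 :=
  (val_isSimplest (zero : N)).eq_zero (fun _ ⟨_, h, _⟩ => (not_move_zero h).elim)
    fun _ ⟨_, h, _⟩ => (not_move_zero h).elim

theorem val_lt_of_left {a b : N} (h : Move .left a b) : val b < val a :=
  (val_isSimplest a).1.2.1 _ ⟨b, h, rfl⟩

theorem val_lt_of_right {a b : N} (h : Move .right a b) : val a < val b :=
  (val_isSimplest a).1.2.2 _ ⟨b, h, rfl⟩

/-- This is Left's good first move in the difference `a - b`, where Left plays Right's moves in `b`.
-/
theorem exists_move_of_lt {a : N} {b : N'} (h : val b < val a) :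
    (∃ a', Move .left a a' ∧ val b ≤ val a') ∨ ∃ b', Move .right b b' ∧ val b' ≤ val a := by
  rcases (val_isSimplest a).exists_option_of_lt (val_isSimplest b) h with
    ⟨_, ⟨a', h1, rfl⟩, h2⟩ | ⟨_, ⟨b', h1, rfl⟩, h2⟩
  · exact .inl ⟨a', h1, h2⟩
  · exact .inr ⟨b', h1, h2⟩

theorem exists_left_of_add_pos {a : N} {b : N'} (h : 0 < val a + val b) :
    (∃ a', Move .left a a' ∧ 0 ≤ val a' + val b) ∨
      ∃ b', Move .left b b' ∧ 0 ≤ val a + val b' := by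
  rcases (val_isSimplest a).exists_option_of_add_pos (val_isSimplest b) h with
    ⟨_, ⟨a', h1, rfl⟩, h2⟩ | ⟨_, ⟨b', h1, rfl⟩, h2⟩
  · exact .inl ⟨a', h1, h2⟩
  · exact .inr ⟨b', h1, h2⟩

theorem exists_left_of_pos {a : N} (h : 0 < val a) : ∃ a', Move .left a a' ∧ 0 ≤ val a' := by
  rcases exists_move_of_lt (a := a) (b := (zero : N)) (by rwa [val_zero]) with
    ⟨a', h1, h2⟩ | ⟨b', h1, -⟩
  · exact ⟨a', h1, by rwa [val_zero] at h2⟩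
  · exact (not_move_zero h1).elim

end NumberGame

/-! ### Nim under both conventions -/

section Nim

variable {ι : Type*}

/-- The bitwise exclusive or of the heap sizes `H i`, `i ∈ A`. -/
def nimSum (A : Finset ι) (H : ι → ℕ) : ℕ := A.fold (· ^^^ ·) 0 H

theorem nimSum_congr {A : Finset ι} {H H' : ι → ℕ} (h : ∀ i ∈ A, H i = H' i) :
    nimSum A H = nimSum A H' := Finset.fold_congr h

open Classical in
/-- The size of the heap that has to be added to a Nim position to make it a win for the player who
has just moved: the Nim sum, with `0` and `1` exchanged if the convention is misère and there are
only heaps of size at most `1`. -/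
noncomputable def nimComplement (c : PlayConvention) (A : Finset ι) (H : ι → ℕ) : ℕ :=
  if c = .misere ∧ ∀ i ∈ A, H i ≤ 1 then nimSum A H ^^^ 1 else nimSum A H

theorem nimComplement_of_small {A : Finset ι} {H : ι → ℕ} (h : ∀ i ∈ A, H i ≤ 1) :
    nimComplement .misere A H = nimSum A H ^^^ 1 := if_pos ⟨rfl, h⟩

theorem nimComplement_of_large (c : PlayConvention) {A : Finset ι} {H : ι → ℕ} {i : ι}
    (hi : i ∈ A) (h : 2 ≤ H i) : nimComplement c A H = nimSum A H :=
  if_neg fun h' => by have := h'.2 i hi; omega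

theorem nimComplement_normal (A : Finset ι) (H : ι → ℕ) :
    nimComplement .normal A H = nimSum A H := if_neg fun h => by cases h.1

theorem nimComplement_congr {c : PlayConvention} {A : Finset ι} {H H' : ι → ℕ}
    (h : ∀ i ∈ A, H i = H' i) : nimComplement c A H = nimComplement c A H' := by
  have e : (∀ i ∈ A, H i ≤ 1) ↔ ∀ i ∈ A, H' i ≤ 1 :=
    forall₂_congr fun i hi => by rw [h i hi]
  unfold nimComplement
  rw [nimSum_congr h]
  by_cases hs : c = .misere ∧ ∀ i ∈ A, H i ≤ 1
  · rw [if_pos hs, if_pos ⟨hs.1, e.1 hs.2⟩]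
  · rw [if_neg hs, if_neg fun h => hs ⟨h.1, e.2 h.2⟩]

variable [DecidableEq ι]

theorem nimSum_insert {A : Finset ι} {a : ι} (ha : a ∉ A) (H : ι → ℕ) :
    nimSum (insert a A) H = H a ^^^ nimSum A H := Finset.fold_insert ha

theorem nimSum_update_of_notMem {A : Finset ι} {a : ι} (ha : a ∉ A) (H : ι → ℕ) (k : ℕ) :
    nimSum A (Function.update H a k) = nimSum A H :=
  nimSum_congr fun _ hi => Function.update_of_ne (ne_of_mem_of_not_mem hi ha) _ _

theorem nimSum_update {A : Finset ι} {a : ι} (ha : a ∈ A) (H : ι → ℕ) (k : ℕ) :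
    nimSum A (Function.update H a k) = nimSum A H ^^^ H a ^^^ k := by
  rw [← Finset.insert_erase ha, nimSum_insert (Finset.notMem_erase a A),
    nimSum_insert (Finset.notMem_erase a A), nimSum_update_of_notMem (Finset.notMem_erase a A),
    Function.update_self, Nat.xor_comm (H a), Nat.xor_xor_cancel_right, Nat.xor_comm]

/-- From `j < x ^^^ y` it follows that `j ^^^ y < x` or `j ^^^ x < y`; induction over the heaps
finds one that can be reduced. -/
theorem exists_xor_lt_of_lt_nimSum {A : Finset ι} {H : ι → ℕ} {j : ℕ} (h : j < nimSum A H) :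
    ∃ i ∈ A, nimSum A H ^^^ H i ^^^ j < H i := by
  induction A using Finset.induction_on generalizing j with
  | empty => simp [nimSum] at h
  | insert a A ha ih =>
    rw [nimSum_insert ha] at h ⊢
    rcases Nat.lt_xor_cases h with h | h
    · refine ⟨a, by simp, ?_⟩
      rw [Nat.xor_comm (H a), Nat.xor_xor_cancel_right, Nat.xor_comm]
      exact h
    · obtain ⟨i, hi, hlt⟩ := ih h
      refine ⟨i, by simp [hi], ?_⟩
      convert hlt using 1
      ac_rfl

/-- From a Nim position one can move to every smaller Nim sum. -/
theorem exists_move_of_lt_nimSum {A : Finset ι} {H : ι → ℕ} {j : ℕ} (h : j < nimSum A H) :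
    ∃ i ∈ A, ∃ k < H i, nimSum A (Function.update H i k) = j := by
  obtain ⟨i, hi, hlt⟩ := exists_xor_lt_of_lt_nimSum h
  refine ⟨i, hi, _, hlt, ?_⟩
  rw [nimSum_update hi]
  generalize nimSum A H ^^^ H i = x
  rw [← Nat.xor_assoc, Nat.xor_self, Nat.zero_xor]

theorem nimSum_le_one {A : Finset ι} {H : ι → ℕ} (h : ∀ i ∈ A, H i ≤ 1) : nimSum A H ≤ 1 := by
  induction A using Finset.induction_on with
  | empty => simp [nimSum]
  | insert a A ha ih =>
    rw [nimSum_insert ha]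
    have h1 := h a (by simp)
    have h2 := ih fun i hi => h i (by simp [hi])
    interval_cases H a <;> interval_cases nimSum A H <;> decide

theorem two_le_nimSum {A : Finset ι} {H : ι → ℕ} {a : ι} (ha : a ∈ A) (h2 : 2 ≤ H a)
    (h : ∀ i ∈ A, i ≠ a → H i ≤ 1) : 2 ≤ nimSum A H := by
  rw [← Finset.insert_erase ha, nimSum_insert (Finset.notMem_erase a A)]
  have := nimSum_le_one (A := A.erase a) (H := H) fun i hi =>
    h i (Finset.mem_of_mem_erase hi) (Finset.ne_of_mem_erase hi)
  by_contra! hlt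
  have e : H a = (H a ^^^ nimSum (A.erase a) H) ^^^ nimSum (A.erase a) H := by
    rw [Nat.xor_xor_cancel_right]
  have : H a ≤ 1 := by
    rw [e]
    generalize H a ^^^ nimSum (A.erase a) H = x at hlt ⊢
    generalize nimSum (A.erase a) H = y at *
    interval_cases x <;> interval_cases y <;> decide
  omega

theorem nimComplement_le_one {c : PlayConvention} {A : Finset ι} {H : ι → ℕ}
    (h : ∀ i ∈ A, H i ≤ 1) : nimComplement c A H ≤ 1 := by
  have := nimSum_le_one h
  cases c
  · rwa [nimComplement_normal]
  · rw [nimComplement_of_small h]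
    interval_cases nimSum A H <;> decide

theorem nimComplement_insert_eq_zero {c : PlayConvention} {A : Finset ι} {a : ι} (ha : a ∉ A)
    (H : ι → ℕ) : nimComplement c (insert a A) H = 0 ↔ H a = nimComplement c A H := by
  cases c
  · simp only [nimComplement_normal, nimSum_insert ha, Nat.xor_eq_zero_iff]
  · by_cases hA : ∀ i ∈ A, H i ≤ 1
    · rw [nimComplement_of_small hA]
      have h1 := nimSum_le_one hA
      by_cases h : H a ≤ 1
      · rw [nimComplement_of_small (by simpa [h] using hA), nimSum_insert ha, Nat.xor_assoc,
          Nat.xor_eq_zero_iff]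
      -- Neither side can hold here: one heap is large, while the small ones have Nim sum and
      -- complement at most 1.
      · rw [nimComplement_of_large _ (Finset.mem_insert_self a A) (by omega), nimSum_insert ha,
          Nat.xor_eq_zero_iff]
        generalize nimSum A H = x at *
        have : x ^^^ 1 ≤ 1 := by interval_cases x <;> decide
        omega
    · push Not at hA
      obtain ⟨i, hi, h⟩ := hA
      rw [nimComplement_of_large _ hi h, nimComplement_of_large _ (Finset.mem_insert_of_mem hi) h,
        nimSum_insert ha, Nat.xor_eq_zero_iff]

theorem nimSum_update_ne {A : Finset ι} {H : ι → ℕ} {a : ι} (ha : a ∈ A) {k : ℕ} (hk : k ≠ H a) :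
    nimSum A (Function.update H a k) ≠ nimSum A H := by
  rw [nimSum_update ha, Nat.xor_assoc]
  intro h
  have h2 : nimSum A H ^^^ (H a ^^^ k) = nimSum A H ^^^ 0 := by rw [h, Nat.xor_zero]
  exact hk (Nat.xor_eq_zero_iff.1 (Nat.xor_right_injective h2)).symm

/-- Xor is injective in each heap, which settles the cases where both sides follow the same formula.
Otherwise a single heap crosses between small and large, so one complement is at most 1 and the
other at least 2. -/
theorem nimComplement_update_ne {c : PlayConvention} {A : Finset ι} {H : ι → ℕ} {a : ι}
    (ha : a ∈ A) {k : ℕ} (hk : k ≠ H a) :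
    nimComplement c A (Function.update H a k) ≠ nimComplement c A H := by
  intro h
  cases c
  · exact nimSum_update_ne ha hk (by simpa only [nimComplement_normal] using h)
  · have hne := nimSum_update_ne ha hk
    by_cases h1 : ∀ i ∈ A, H i ≤ 1 <;> by_cases h2 : ∀ i ∈ A, Function.update H a k i ≤ 1
    · rw [nimComplement_of_small h1, nimComplement_of_small h2] at h
      exact hne (Nat.xor_left_injective h)
    · have hle := nimComplement_le_one (c := .misere) h1
      push Not at h2
      obtain ⟨i, hi, h2⟩ := h2
      have hia : i = a := by
        by_contra hia
        rw [Function.update_of_ne hia] at h2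
        exact absurd (h1 i hi) (by omega)
      subst hia
      have := two_le_nimSum (H := Function.update H i k) ha h2 fun j hj hji => by
        rw [Function.update_of_ne hji]; exact h1 j hj
      rw [nimComplement_of_large _ ha h2] at h
      omega
    · have hle := nimComplement_le_one (c := .misere) h2
      push Not at h1
      obtain ⟨i, hi, h1⟩ := h1
      have hia : i = a := by
        by_contra hia
        have := h2 i hi
        rw [Function.update_of_ne hia] at this
        omega
      subst hia
      have := two_le_nimSum (H := H) ha h1 fun j hj hji => by
        have := h2 j hj
        rwa [Function.update_of_ne hji] at this
      rw [nimComplement_of_large _ ha h1] at h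
      omega
    · push Not at h1 h2
      obtain ⟨i, hi, h1⟩ := h1
      obtain ⟨j, hj, h2⟩ := h2
      rw [nimComplement_of_large _ hi h1, nimComplement_of_large _ hj h2] at h
      exact hne h

/-- The hypothesis `hH` excludes the misère position without heaps, whose complement is 1 although
no move exists. -/
theorem exists_move_of_lt_nimComplement {c : PlayConvention} {A : Finset ι} {H : ι → ℕ} {j : ℕ}
    (hH : c = .misere → ∃ i ∈ A, H i ≠ 0) (hj : j < nimComplement c A H) :
    ∃ i ∈ A, ∃ k < H i, nimComplement c A (Function.update H i k) = j := by
  cases c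
  · simp only [nimComplement_normal] at hj ⊢
    exact exists_move_of_lt_nimSum hj
  by_cases hs : ∀ i ∈ A, H i ≤ 1
  · obtain ⟨i, hi, h0⟩ := hH rfl
    have h1 := hs i hi
    have hle := nimComplement_le_one (c := .misere) hs
    -- The complement is 1 and `j` is 0, so emptying any nonempty heap flips it as required.
    refine ⟨i, hi, 0, by omega, ?_⟩
    have hs' : ∀ l ∈ A, Function.update H i 0 l ≤ 1 := fun l hl => by
      rw [Function.update_apply]
      split_ifs
      · omega
      · exact hs l hl
    have hle' := nimComplement_le_one (c := .misere) hs'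
    have := nimComplement_update_ne (c := .misere) hi (Ne.symm h0)
    omega
  · push Not at hs
    obtain ⟨l, hl, hs⟩ := hs
    rw [nimComplement_of_large _ hl hs] at hj
    obtain ⟨i, hi, k, hk, hkj⟩ := exists_move_of_lt_nimSum hj
    by_cases hs' : ∀ m ∈ A, Function.update H i k m ≤ 1
    · have hil : l = i := by
        by_contra hil
        have := hs' l hl
        rw [Function.update_of_ne hil] at this
        omega
      subst hil
      have hk1 := hs' l hl
      rw [Function.update_self] at hk1
      -- The Nim move reduces the only large heap to a small one. The misère rule then swaps 0 and
      -- 1, so the new size is swapped too.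
      have hk2 : k ^^^ 1 ≤ 1 := by interval_cases k <;> decide
      refine ⟨l, hl, k ^^^ 1, by omega, ?_⟩
      rw [nimComplement_of_small, nimSum_update hl, ← hkj, nimSum_update hl, ← Nat.xor_assoc,
        Nat.xor_xor_cancel_right]
      intro m hm
      have := hs' m hm
      rw [Function.update_apply] at this ⊢
      split_ifs at this ⊢
      · exact hk2
      · exact this
    · push Not at hs'
      obtain ⟨m, hm, hs'⟩ := hs'
      exact ⟨i, hi, k, hk, by rw [nimComplement_of_large _ hm hs', hkj]⟩

end Nim

theorem nimComplement_update_of_notMem {ι : Type*} [DecidableEq ι] {c : PlayConvention}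
    {A : Finset ι} {a : ι} (ha : a ∉ A) (H : ι → ℕ) (k : ℕ) :
    nimComplement c A (Function.update H a k) = nimComplement c A H :=
  nimComplement_congr fun _ hi => Function.update_of_ne (ne_of_mem_of_not_mem hi ha) _ _

/-! ### Abstract sums of flowers and monotonicity -/

/-- A position in a sum of flowers: the heights of the stems and the positions on the blossoms. -/
abbrev FlowerState {ι : Type*} (N : ι → Type*) := ∀ i, ℕ × N i

namespace FlowerState

open NumberGame Function

variable {ι : Type*} {N : ι → Type*} [∀ i, NumberGame (N i)]

def heights (s : FlowerState N) : ι → ℕ := fun i => (s i).1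

/-- `t` arises from `s` by making some blossoms worse for Left. -/
def Le (t s : FlowerState N) : Prop :=
  ∀ i, (t i).1 = (s i).1 ∧ (0 < (s i).1 → val (t i).2 ≤ val (s i).2)

def blue (s : FlowerState N) : Set ι := {i | 0 < (s i).1 ∧ 0 < val (s i).2}

def red (s : FlowerState N) : Set ι := {i | 0 < (s i).1 ∧ val (s i).2 < 0}

variable (N) in
/-- The position without blossoms, which is a Nim position. -/
def bare (H : ι → ℕ) : FlowerState N := fun i => (H i, zero)

open Classical in
/-- Remove all blossoms outside of `X`. -/
noncomputable def restrict (s : FlowerState N) (X : Set ι) : FlowerState N :=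
  fun i => if i ∈ X then s i else ((s i).1, zero)

theorem restrict_of_mem {s : FlowerState N} {X : Set ι} {i : ι} (h : i ∈ X) :
    s.restrict X i = s i := if_pos h

theorem restrict_of_notMem {s : FlowerState N} {X : Set ι} {i : ι} (h : i ∉ X) :
    s.restrict X i = ((s i).1, zero) := if_neg h

/-- No deleted blossom on a standing stem is red. With `wins_mono` this reduces a position to a few
flowers among Stalks. -/
theorem restrict_le {s : FlowerState N} {X : Set ι} (h : s.red ⊆ X) : Le (s.restrict X) s := by
  intro i
  by_cases hi : i ∈ X
  · rw [restrict_of_mem hi]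
    exact ⟨rfl, fun _ => le_rfl⟩
  · rw [restrict_of_notMem hi]
    refine ⟨rfl, fun h0 => ?_⟩
    rw [val_zero]
    by_contra! hlt
    exact hi (h ⟨h0, hlt⟩)

theorem bare_heights_le {s : FlowerState N} (h : ∀ i, 0 ≤ val (s i).2) : Le (bare N s.heights) s :=
  fun i => ⟨rfl, fun _ => by simpa [bare, val_zero] using h i⟩

variable [DecidableEq ι]

/-- A move: either the stem of a flower is cut, leaving a shorter stem without blossom, or a move
is made in the blossom of a flower. -/
inductive Step (p : Player) (s : FlowerState N) : FlowerState N → Prop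
  | stem (i : ι) (k : ℕ) : k < (s i).1 → Step p s (update s i (k, zero))
  | blossom (i : ι) (b : N i) : 0 < (s i).1 → Move p (s i).2 b →
      Step p s (update s i ((s i).1, b))

theorem heights_update {ι : Type*} {N : ι → Type*} [DecidableEq ι] (s : FlowerState N) (i : ι) (x : ℕ × N i) :
    heights (update s i x) = update s.heights i x.1 := by
  ext j
  rcases eq_or_ne j i with rfl | h
  · simp [heights]
  · simp [heights, h]

theorem update_bare (H : ι → ℕ) (i : ι) (k : ℕ) :
    update (bare N H) i (k, zero) = bare N (update H i k) := by
  ext j : 1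
  rcases eq_or_ne j i with rfl | h
  · simp [bare]
  · simp [bare, h]

theorem Le.update_both {s t : FlowerState N} (h : Le t s) (i : ι) {x y : ℕ × N i}
    (h1 : x.1 = y.1) (h2 : val x.2 ≤ val y.2) : Le (update t i x) (update s i y) := by
  intro j
  rcases eq_or_ne j i with rfl | hj
  · simpa [h1] using fun _ => h2
  · simpa [hj] using h j

theorem Le.update_right {s t : FlowerState N} (h : Le t s) (i : ι) {y : ℕ × N i}
    (h1 : y.1 = (s i).1) (h2 : val (t i).2 ≤ val y.2) : Le t (update s i y) := by
  simpa using h.update_both i (x := t i) (y := y) ((h i).1.trans h1.symm) h2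

theorem Le.update_left {s t : FlowerState N} (h : Le t s) (i : ι) {x : ℕ × N i}
    (h1 : x.1 = (t i).1) (h2 : val x.2 ≤ val (s i).2) : Le (update t i x) s := by
  simpa using h.update_both i (x := x) (y := s i) (h1.trans (h i).1) h2

theorem blue_update_zero (s : FlowerState N) (i : ι) (k : ℕ) :
    blue (update s i (k, zero)) = s.blue \ {i} := by
  ext j
  rcases eq_or_ne j i with rfl | hj
  · simp [blue, val_zero]
  · simp [blue, hj]

theorem red_update_zero (s : FlowerState N) (i : ι) (k : ℕ) :
    red (update s i (k, zero)) = s.red \ {i} := by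
  ext j
  rcases eq_or_ne j i with rfl | hj
  · simp [red, val_zero]
  · simp [red, hj]

theorem blue_subset_update {s : FlowerState N} {i : ι} {b : N i} (h : Move .right (s i).2 b) :
    s.blue ⊆ blue (update s i ((s i).1, b)) := by
  intro j hj
  rcases eq_or_ne j i with rfl | hji
  · simpa [blue] using And.intro hj.1 (hj.2.trans (val_lt_of_right h))
  · simpa [blue, hji] using hj

theorem red_update_subset {s : FlowerState N} {i : ι} {b : N i} (h : Move .right (s i).2 b) :
    red (update s i ((s i).1, b)) ⊆ s.red := by
  intro j hj
  rcases eq_or_ne j i with rfl | hji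
  · have : 0 < (s j).1 ∧ val b < 0 := by simpa [red] using hj
    exact ⟨this.1, (val_lt_of_right h).trans this.2⟩
  · simpa [red, hji] using hj

theorem val_update_zero_nonneg {s : FlowerState N} {a : ι} (h : ∀ i ≠ a, 0 ≤ val (s i).2) (k : ℕ) (i : ι) :
    0 ≤ val (update s a (k, zero) i).2 := by
  rcases eq_or_ne i a with rfl | hi
  · simp [val_zero]
  · simpa [hi] using h i hi

variable [Fintype ι]

def size (s : FlowerState N) : ℕ := ∑ i, ((s i).1 + NumberGame.size (s i).2)

theorem size_update_lt {s : FlowerState N} {i : ι} {x : ℕ × N i}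
    (h : x.1 + NumberGame.size x.2 < (s i).1 + NumberGame.size (s i).2) :
    size (update s i x) < size s := by
  refine Finset.sum_lt_sum (fun j _ => ?_) ⟨i, Finset.mem_univ i, by simpa using h⟩
  rcases eq_or_ne j i with rfl | hj
  · simpa using h.le
  · simp [hj]

theorem size_update_zero_lt {s : FlowerState N} {i : ι} {k : ℕ} (h : k < (s i).1) :
    size (update s i (k, zero)) < size s :=
  size_update_lt (by simp only [size_zero]; omega)

theorem size_update_blossom_lt {p : Player} {s : FlowerState N} {i : ι} {b : N i}
    (h : Move p (s i).2 b) : size (update s i ((s i).1, b)) < size s :=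
  size_update_lt (by have := NumberGame.size_lt h; simp only; omega)

theorem Step.size_lt {p : Player} {s t : FlowerState N} (h : Step p s t) : size t < size s := by
  cases h with
  | stem i k hk => exact size_update_zero_lt hk
  | blossom i b _ hb => exact size_update_blossom_lt hb

/-- The player `p`, who is to move, wins. -/
def Wins {ι : Type*} {N : ι → Type*} [∀ i, NumberGame (N i)] [DecidableEq ι] [Fintype ι]
    (c : PlayConvention) (p : Player) (s : FlowerState N) : Prop :=
  (c = .misere ∧ ∀ t, ¬ Step p s t) ∨ ∃ t, ∃ _ : Step p s t, ¬ Wins c p.other t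
termination_by size s
decreasing_by exact Step.size_lt ‹_›

variable {c : PlayConvention} {s t : FlowerState N}

theorem Wins.of_step {p : Player} (h : Step p s t) (ht : ¬ Wins c p.other t) : Wins c p s := by
  rw [Wins]
  exact .inr ⟨t, h, ht⟩

theorem wins_left_of_step (h : Step .left s t) (ht : ¬ Wins c .right t) : Wins c .left s :=
  .of_step h ht

theorem not_wins_right (h : c = .misere → ∃ i, 0 < (s i).1)
    (ht : ∀ t, Step .right s t → Wins c .left t) : ¬ Wins c .right s := by
  rw [Wins]
  rintro (⟨hc, hs⟩ | ⟨t, hst, hn⟩)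
  · obtain ⟨i, hi⟩ := h hc
    exact hs _ (.stem i 0 hi)
  · exact hn (ht t hst)

theorem wins_left_of_step_right (h : ¬ Wins c .right s) (hst : Step .right s t) :
    Wins c .left t := by
  by_contra hn
  exact h (.of_step hst hn)

theorem exists_pos_of_not_wins {p : Player} (h : ¬ Wins c p s) (hc : c = .misere) :
    ∃ i, 0 < (s i).1 := by
  by_contra! hs
  rw [Wins] at h
  refine h (.inl ⟨hc, fun t ht => ?_⟩)
  cases ht with
  | stem i k hk => have := hs i; omega
  | blossom i b h0 _ => have := hs i; omega

/-- Blossoms of larger value are at least as good for Left, under both conventions. -/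
theorem wins_mono (c : PlayConvention) (s t : FlowerState N) (h : Le t s) :
    (Wins c .left t → Wins c .left s) ∧ (¬ Wins c .right t → ¬ Wins c .right s) := by
  induction hn : size s + size t using Nat.strong_induction_on generalizing s t with
  | _ n ih =>
  constructor
  · intro ht
    rw [Wins] at ht
    rcases ht with ⟨hc, ht⟩ | ⟨t', htt', ht'⟩
    · rw [Wins]
      refine .inl ⟨hc, fun s' hs' => ?_⟩
      have h0 : ∀ i, (s i).1 = 0 := fun i => by
        rw [← (h i).1]
        by_contra hi
        exact ht _ (.stem i 0 (Nat.pos_of_ne_zero hi))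
      cases hs' with
      | stem i k hk => have := h0 i; omega
      | blossom i b hi _ => have := h0 i; omega
    · have hlt := htt'.size_lt
      cases htt' with
      | stem i k hk =>
        have hk' : k < (s i).1 := (h i).1 ▸ hk
        have := size_update_zero_lt hk'
        exact wins_left_of_step (.stem i k hk')
          ((ih _ (by omega) _ _ (h.update_both i rfl le_rfl) rfl).2 ht')
      | blossom i b h0 hb =>
        have h0' : 0 < (s i).1 := (h i).1 ▸ h0
        have hv := (val_lt_of_left hb).trans_le ((h i).2 h0')
        -- Either `s` has a blossom move at least as good as `b`, or Right can reverse `b`. The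
        -- reversed position is won by Left and is still below `s`, so induction applies to it.
        rcases exists_move_of_lt hv with ⟨a, ha, hav⟩ | ⟨a, ha, hav⟩
        · have := size_update_blossom_lt ha
          exact wins_left_of_step (.blossom i a h0' ha)
            ((ih _ (by omega) _ _ (h.update_both i (x := ((t i).1, b)) (y := ((s i).1, a)) (h i).1 hav) rfl).2 ht')
        · have hst : Step .right (update t i ((t i).1, b))
              (update (update t i ((t i).1, b)) i ((t i).1, a)) := by
            have := Step.blossom (p := .right) (s := update t i ((t i).1, b)) i a
              (by simpa using h0) (by simpa using ha)
            simpa using this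
          have hlt' := hst.size_lt
          refine (ih _ (by omega) _ _ ?_ rfl).1 (wins_left_of_step_right ht' hst)
          rw [update_idem]
          exact h.update_left i rfl hav
  · intro ht
    refine not_wins_right (fun hc => ?_) fun s' hss' => ?_
    · obtain ⟨i, hi⟩ := exists_pos_of_not_wins ht hc
      exact ⟨i, (h i).1 ▸ hi⟩
    · have hlt := hss'.size_lt
      cases hss' with
      | stem i k hk =>
        have hk' : k < (t i).1 := (h i).1 ▸ hk
        have := size_update_zero_lt hk'
        exact (ih _ (by omega) _ _ (h.update_both i rfl le_rfl) rfl).1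
          (wins_left_of_step_right ht (.stem i k hk'))
      | blossom i b h0 hb =>
        have h0' : 0 < (t i).1 := (h i).1 ▸ h0
        have hv := ((h i).2 h0).trans_lt (val_lt_of_right hb)
        -- Dually, either Left can reverse Right's move to a position still above `t`, or Right has
        -- a move in `t` that is at least as good for Right.
        rcases exists_move_of_lt hv with ⟨a, ha, hav⟩ | ⟨a, ha, hav⟩
        · have hst : Step .left (update s i ((s i).1, b))
              (update (update s i ((s i).1, b)) i ((s i).1, a)) := by
            have := Step.blossom (p := .left) (s := update s i ((s i).1, b)) i a
              (by simpa using h0) (by simpa using ha)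
            simpa using this
          have hlt' := hst.size_lt
          refine wins_left_of_step hst ((ih _ (by omega) _ _ ?_ rfl).2 ht)
          rw [update_idem]
          exact h.update_right i rfl hav
        · have := size_update_blossom_lt ha
          exact (ih _ (by omega) _ _ (h.update_both i (x := ((t i).1, a)) (y := ((s i).1, b)) (h i).1 hav) rfl).1
            (wins_left_of_step_right ht (.blossom i a h0' ha))

/-- Without blossoms both players have the same moves, and complement 0 marks the positions lost for
the player on move. The empty misère position has complement 1, in accordance with the mover winning
there. -/
theorem wins_bare (c : PlayConvention) (H : ι → ℕ) :
    (nimComplement c Finset.univ H = 0 → ¬ Wins c .right (bare N H)) ∧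
      (nimComplement c Finset.univ H ≠ 0 → Wins c .left (bare N H)) := by
  induction hn : size (bare N H) using Nat.strong_induction_on generalizing H with
  | _ n ih =>
  constructor
  · intro h
    refine not_wins_right (fun hc => ?_) fun t ht => ?_
    · by_contra! h0
      subst hc
      have h0' : ∀ i ∈ (Finset.univ : Finset ι), H i = (fun _ => 0) i :=
        fun i _ => Nat.le_zero.1 (h0 i)
      rw [nimComplement_congr h0', nimComplement_of_small (by simp)] at h
      have hz : ∀ A : Finset ι, nimSum A (fun _ => 0) = 0 := fun A => by
        induction A using Finset.induction_on with
        | empty => rfl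
        | insert a A ha ih => rw [nimSum_insert ha, ih, Nat.xor_self]
      rw [hz] at h
      exact absurd h (by decide)
    · have hlt := ht.size_lt
      cases ht with
      | stem i k hk =>
        rw [update_bare] at hlt ⊢
        refine (ih _ (hn ▸ hlt) _ rfl).2 ?_
        rw [← h]
        exact nimComplement_update_ne (Finset.mem_univ i) hk.ne
      | blossom i b _ hb => exact (not_move_zero hb).elim
  · intro h
    by_cases hH : c = .misere → ∃ i ∈ Finset.univ, H i ≠ 0
    · obtain ⟨i, -, k, hk, h0⟩ := exists_move_of_lt_nimComplement hH (Nat.pos_of_ne_zero h)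
      have hst : Step .left (bare N H) (update (bare N H) i (k, zero)) := .stem i k hk
      have hlt := hst.size_lt
      refine wins_left_of_step hst ?_
      rw [update_bare] at hlt ⊢
      exact (ih _ (hn ▸ hlt) _ rfl).1 h0
    · push Not at hH
      rw [Wins]
      refine .inl ⟨hH.1, fun t ht => ?_⟩
      cases ht with
      | stem i k hk =>
        have h0 : H i = 0 := hH.2 i (Finset.mem_univ i)
        have : k < H i := hk
        omega
      | blossom i b _ hb => exact not_move_zero hb

theorem not_wins_right_of_nim (h : ∀ i, 0 ≤ val (s i).2)
    (h0 : nimComplement c Finset.univ s.heights = 0) : ¬ Wins c .right s :=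
  (wins_mono c _ _ (bare_heights_le h)).2 ((wins_bare c _).1 h0)

theorem wins_left_of_nim (h : ∀ i, 0 ≤ val (s i).2)
    (h0 : nimComplement c Finset.univ s.heights ≠ 0) : Wins c .left s :=
  (wins_mono c _ _ (bare_heights_le h)).1 ((wins_bare c _).2 h0)

theorem nimComplement_univ_eq_zero (c : PlayConvention) (H : ι → ℕ) (a : ι) :
    nimComplement c Finset.univ H = 0 ↔ H a = nimComplement c (Finset.univ.erase a) H := by
  rw [← nimComplement_insert_eq_zero (Finset.notMem_erase a _),
    Finset.insert_erase (Finset.mem_univ a)]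

/-! ### One or two flowers among Stalks -/

/-- A blue flower together with Stalks. -/
theorem wins_single (c : PlayConvention) (s : FlowerState N) (a : ι) (ha : a ∈ s.blue)
    (hz : ∀ i ≠ a, (s i).2 = zero) :
    ((s a).1 ≤ nimComplement c (Finset.univ.erase a) s.heights → ¬ Wins c .right s) ∧
      Wins c .left s := by
  induction hn : size s using Nat.strong_induction_on generalizing s with
  | _ n ih =>
  have hmem := Finset.notMem_erase a (Finset.univ : Finset ι)
  have hval : ∀ i ≠ a, 0 ≤ val (s i).2 := fun i hi => by rw [hz i hi, val_zero]
  have hstem : ∀ i ≠ a, ∀ k, a ∈ blue (update s i (k, zero)) ∧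
      (∀ j ≠ a, (update s i (k, zero) j).2 = zero) ∧ (update s i (k, zero) a).1 = (s a).1 ∧
      heights (update s i (k, zero)) = update s.heights i k := by
    intro i hi k
    refine ⟨?_, fun j hj => ?_, by simp [hi.symm], heights_update _ _ _⟩
    · rw [blue_update_zero]
      exact ⟨ha, hi.symm⟩
    · rcases eq_or_ne j i with rfl | hji
      · simp
      · simpa [hji] using hz j hj
  have hblossom : ∀ x, 0 < val x → a ∈ blue (update s a ((s a).1, x)) ∧
      (∀ j ≠ a, (update s a ((s a).1, x) j).2 = zero) ∧
      (update s a ((s a).1, x) a).1 = (s a).1 := by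
    intro x hx
    refine ⟨by simpa [blue, hx] using ha.1, fun j hj => by simpa [hj] using hz j hj, by simp⟩
  constructor
  · intro h
    refine not_wins_right (fun _ => ⟨a, ha.1⟩) fun t ht => ?_
    have hlt := ht.size_lt
    cases ht with
    | stem i k hk =>
      rcases eq_or_ne i a with rfl | hi
      · refine wins_left_of_nim (val_update_zero_nonneg hval k) ?_
        rw [Ne, nimComplement_univ_eq_zero _ _ i, heights_update,
          nimComplement_update_of_notMem hmem, update_self]
        omega
      · exact (ih _ (hn ▸ hlt) _ (hstem i hi k).1 (hstem i hi k).2.1 rfl).2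
    | blossom i b h0 hb =>
      rcases eq_or_ne i a with rfl | hi
      · obtain ⟨h1, h2, -⟩ := hblossom b (ha.2.trans (val_lt_of_right hb))
        exact (ih _ (hn ▸ hlt) _ h1 h2 rfl).2
      · rw [hz i hi] at hb
        exact (not_move_zero hb).elim
  -- Left compares the stem with the complement of the Stalks. A longer stem is cut down to it; at
  -- equality a blossom move passes the turn; a shorter stem is matched by shortening a Stalk.
  · rcases lt_trichotomy (nimComplement c (Finset.univ.erase a) s.heights) (s a).1 with h | h | h
    · refine wins_left_of_step (.stem a _ h)
        (not_wins_right_of_nim (val_update_zero_nonneg hval _) ?_)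
      rw [nimComplement_univ_eq_zero _ _ a, heights_update, nimComplement_update_of_notMem hmem,
        update_self]
    · obtain ⟨x, hx, hx0⟩ := exists_left_of_pos ha.2
      have hst : Step .left s (update s a ((s a).1, x)) := .blossom a x ha.1 hx
      have hlt := hst.size_lt
      have hH : heights (update s a ((s a).1, x)) = s.heights := by
        rw [heights_update]
        exact update_eq_self a s.heights
      refine wins_left_of_step hst ?_
      rcases hx0.eq_or_lt with hx0 | hx0
      · refine not_wins_right_of_nim (fun i => ?_) ?_
        · rcases eq_or_ne i a with rfl | hi
          · simpa using hx0.le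
          · simpa [hi] using hval i hi
        · rw [nimComplement_univ_eq_zero _ _ a, hH, h]
          rfl
      · obtain ⟨h1, h2, h3⟩ := hblossom x hx0
        refine (ih _ (hn ▸ hlt) _ h1 h2 rfl).1 ?_
        rw [h3, hH, h]
    · have hH : c = .misere → ∃ i ∈ Finset.univ.erase a, s.heights i ≠ 0 := by
        rintro rfl
        by_contra! h0
        have hle : nimComplement .misere (Finset.univ.erase a) s.heights ≤ 1 :=
          nimComplement_le_one fun i hi => by rw [h0 i hi]; omega
        have := ha.1
        omega
      obtain ⟨i, hi, k, hk, hik⟩ := exists_move_of_lt_nimComplement hH h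
      obtain ⟨h1, h2, h3, h4⟩ := hstem i (Finset.ne_of_mem_erase hi) k
      have hst : Step .left s (update s i (k, zero)) := .stem i k hk
      refine wins_left_of_step hst ((ih _ (hn ▸ hst.size_lt) _ h1 h2 rfl).1 ?_)
      rw [h3, h4, hik]

/-- The complement is at most 1 if all heaps are small and equals `j` otherwise. The bound `2 ≤ h`
is needed for misère play, where it can be 1 with `j = 0`. -/
theorem nimComplement_insert_lt {c : PlayConvention} {A : Finset ι} {a : ι} (ha : a ∉ A)
    {H : ι → ℕ} (h0 : nimSum A H = 0) {j h : ℕ} (hj : j < h) (h2 : 2 ≤ h) :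
    nimComplement c (insert a A) (update H a j) < h := by
  by_cases hs : ∀ i ∈ insert a A, update H a j i ≤ 1
  · exact (nimComplement_le_one hs).trans_lt h2
  · push Not at hs
    obtain ⟨i, hi, hs⟩ := hs
    rw [nimComplement_of_large _ hi hs, nimSum_insert ha, nimSum_update_of_notMem ha, h0, update_self,
      Nat.xor_zero]
    exact hj

/-- Left answers the cut by cutting the twin stem to the Nim complement of the rest. This also
removes the twin's blossom, so its sign is irrelevant. -/
theorem wins_left_update_of_pair {a b : ι} (hab : a ≠ b) (hh : (s a).1 = (s b).1)
    (h2 : 2 ≤ (s a).1) (hz : ∀ i, i ≠ a → i ≠ b → (s i).2 = zero)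
    (h0 : nimSum ((Finset.univ.erase a).erase b) s.heights = 0) {j : ℕ} (hj : j < (s a).1) :
    Wins c .left (update s a (j, zero)) := by
  have haA : a ∉ (Finset.univ.erase a).erase b := by simp
  have hlt : nimComplement c (Finset.univ.erase b) (update s.heights a j) < (s b).1 := by
    have := nimComplement_insert_lt (c := c) haA h0 hj h2
    rwa [Finset.erase_right_comm, Finset.insert_erase (by simp [hab]), hh] at this
  have hsb : (update s a (j, zero) b).1 = (s b).1 := by simp [hab.symm]
  refine wins_left_of_step (.stem b _ (hsb ▸ hlt))
    (not_wins_right_of_nim (val_update_zero_nonneg (fun i hi => ?_) _) ?_)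
  · rcases eq_or_ne i a with rfl | hia
    · simp [val_zero]
    · simp [hia, hz i hia hi, val_zero]
  · rw [nimComplement_univ_eq_zero _ _ b, heights_update, heights_update,
      nimComplement_update_of_notMem (Finset.notMem_erase b _), update_self]

/-- Two flowers of the same height at least `2` with blossoms of nonnegative total value, together
with Stalks of Nim sum `0`. -/
theorem not_wins_right_pair (c : PlayConvention) (s : FlowerState N) {a b : ι} (hab : a ≠ b)
    (hh : (s a).1 = (s b).1) (h2 : 2 ≤ (s a).1) (hz : ∀ i, i ≠ a → i ≠ b → (s i).2 = zero)
    (hv : 0 ≤ val (s a).2 + val (s b).2)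
    (h0 : nimSum ((Finset.univ.erase a).erase b) s.heights = 0) : ¬ Wins c .right s := by
  induction hn : size s using Nat.strong_induction_on generalizing s with
  | _ n ih =>
  -- A blossom move of Right makes the total value positive; Left answers in one of the two blossoms
  -- and keeps it nonnegative.
  have hstem : ∀ {t : FlowerState N}, Step .right s t → (t a).1 = (s a).1 → (t b).1 = (s b).1 →
      (∀ i, i ≠ a → i ≠ b → (t i).2 = zero) → 0 < val (t a).2 + val (t b).2 →
      nimSum ((Finset.univ.erase a).erase b) t.heights = 0 → Wins c .left t := by
    intro t hst hta htb htz htv ht0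
    have hlt := hst.size_lt
    rcases exists_left_of_add_pos htv with ⟨x, hx, hx0⟩ | ⟨x, hx, hx0⟩
    · have hst' : Step .left t (update t a ((t a).1, x)) := .blossom a x (by omega) hx
      refine wins_left_of_step hst' (ih _ (hn ▸ hst'.size_lt.trans hlt) _ ?_ ?_ ?_ ?_ ?_ rfl)
      · simp [hab.symm, hta, htb, hh]
      · simpa [hta] using h2
      · exact fun i hia hib => by simpa [hia] using htz i hia hib
      · simpa [hab.symm] using hx0
      · rw [heights_update, nimSum_update_of_notMem (by simp), ht0]
    · have hst' : Step .left t (update t b ((t b).1, x)) := .blossom b x (by omega) hx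
      refine wins_left_of_step hst' (ih _ (hn ▸ hst'.size_lt.trans hlt) _ ?_ ?_ ?_ ?_ ?_ rfl)
      · simp [hab, hta, htb, hh]
      · simpa [hab, hta] using h2
      · exact fun i hia hib => by simpa [hib] using htz i hia hib
      · simpa [hab] using hx0
      · rw [heights_update, nimSum_update_of_notMem (by simp), ht0]
  refine not_wins_right (fun _ => ⟨a, by omega⟩) fun t ht => ?_
  have ht' := ht
  cases ht with
  | stem i k hk =>
    rcases eq_or_ne i a with rfl | hia
    · exact wins_left_update_of_pair hab hh h2 hz h0 hk
    rcases eq_or_ne i b with rfl | hib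
    · exact wins_left_update_of_pair hab.symm hh.symm (hh ▸ h2) (fun j h1 h2 => hz j h2 h1)
        (by rwa [Finset.erase_right_comm]) hk
    have hiA : i ∈ (Finset.univ.erase a).erase b := by simp [hia, hib]
    have hne := nimSum_update_ne (H := s.heights) hiA hk.ne
    rw [h0] at hne
    -- Left restores Nim sum 0 among the Stalks. The plain Nim sum serves both conventions while the
    -- two tall stems stand.
    obtain ⟨j, hjA, l, hl, hj0⟩ := exists_move_of_lt_nimSum (Nat.pos_of_ne_zero hne)
    have hja : j ≠ a := by rintro rfl; simp at hjA
    have hjb : j ≠ b := by rintro rfl; simp at hjA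
    rw [← heights_update s i (k, zero)] at hl hj0
    have hst' : Step .left (update s i (k, zero)) (update (update s i (k, zero)) j (l, zero)) :=
      .stem j l hl
    refine wins_left_of_step hst' (ih _ (hn ▸ hst'.size_lt.trans ht'.size_lt) _ ?_ ?_ ?_ ?_ ?_ rfl)
    · simpa [hia.symm, hib.symm, hja.symm, hjb.symm] using hh
    · simpa [hia.symm, hja.symm] using h2
    · intro m hma hmb
      rcases eq_or_ne m j with rfl | hmj
      · simp
      rcases eq_or_ne m i with rfl | hmi
      · simp [hmj]
      · simpa [hmj, hmi] using hz m hma hmb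
    · simpa [hia.symm, hib.symm, hja.symm, hjb.symm] using hv
    · rw [heights_update, hj0]
  | blossom i x hi hx =>
    have hlt := val_lt_of_right hx
    rcases eq_or_ne i a with rfl | hia
    · refine hstem ht' (by simp) (by simp [hab.symm])
        (fun j h1 h2 => by simpa [h1] using hz j h1 h2) ?_ ?_
      · simp only [update_self, update_of_ne hab.symm]
        linarith
      · rw [heights_update, nimSum_update_of_notMem (by simp), h0]
    rcases eq_or_ne i b with rfl | hib
    · refine hstem ht' (by simp [hab]) (by simp)
        (fun j h1 h2 => by simpa [h2] using hz j h1 h2) ?_ ?_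
      · simp only [update_self, update_of_ne hab]
        linarith
      · rw [heights_update, nimSum_update_of_notMem (by simp), h0]
    · rw [hz i hia hib] at hx
      exact (not_move_zero hx).elim

theorem wins_left_pair {a b : ι} (hab : a ≠ b)
    (hh : (s a).1 = (s b).1) (h2 : 2 ≤ (s a).1) (hz : ∀ i, i ≠ a → i ≠ b → (s i).2 = zero)
    (hv : 0 < val (s a).2 + val (s b).2) : Wins c .left s := by
  by_cases h0 : nimSum ((Finset.univ.erase a).erase b) s.heights = 0
  · rcases exists_left_of_add_pos hv with ⟨x, hx, hx0⟩ | ⟨x, hx, hx0⟩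
    · refine wins_left_of_step (.blossom a x (by omega) hx)
        (not_wins_right_pair c _ hab ?_ ?_ ?_ ?_ ?_)
      · simp [hab.symm, hh]
      · simpa using h2
      · exact fun i hia hib => by simpa [hia] using hz i hia hib
      · simpa [hab.symm] using hx0
      · rw [heights_update, nimSum_update_of_notMem (by simp), h0]
    · refine wins_left_of_step (.blossom b x (by omega) hx)
        (not_wins_right_pair c _ hab ?_ ?_ ?_ ?_ ?_)
      · simp [hab, hh]
      · simpa [hab] using h2
      · exact fun i hia hib => by simpa [hib] using hz i hia hib
      · simpa [hab] using hx0
      · rw [heights_update, nimSum_update_of_notMem (by simp), h0]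
  · obtain ⟨i, hiA, k, hk, hi0⟩ := exists_move_of_lt_nimSum (Nat.pos_of_ne_zero h0)
    have hia : i ≠ a := by rintro rfl; simp at hiA
    have hib : i ≠ b := by rintro rfl; simp at hiA
    refine wins_left_of_step (.stem i k hk) (not_wins_right_pair c _ hab ?_ ?_ ?_ ?_ ?_)
    · simpa [hia.symm, hib.symm] using hh
    · simpa [hia.symm] using h2
    · intro m hma hmb
      rcases eq_or_ne m i with rfl | hmi
      · simp
      · simpa [hmi] using hz m hma hmb
    · simpa [hia.symm, hib.symm] using hv.le
    · rw [heights_update, hi0]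

/-- A blue flower and a taller red flower, together with Stalks. -/
theorem wins_left_of_taller_red {a b : ι} (ha : a ∈ s.blue) (hh : (s a).1 < (s b).1)
    (hz : ∀ i, i ≠ a → i ≠ b → (s i).2 = zero) : Wins c .left s := by
  have hab : a ≠ b := by rintro rfl; omega
  have hb : b ∈ Finset.univ.erase a := by simp [hab.symm]
  -- Distinct heights of `b` give distinct complements, so the heights from 0 to that of `a` cannot
  -- all give complements below the height of `a`.
  obtain ⟨j, hj, hle⟩ : ∃ j ≤ (s a).1,
      (s a).1 ≤ nimComplement c (Finset.univ.erase a) (update s.heights b j) := by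
    by_contra! hcon
    obtain ⟨x, hx, y, hy, hxy, he⟩ := Finset.exists_ne_map_eq_of_card_lt_of_maps_to
      (s := Finset.range ((s a).1 + 1)) (t := Finset.range (s a).1) (by simp)
      (f := fun j => nimComplement c (Finset.univ.erase a) (update s.heights b j))
      (fun j hj => by
        have := hcon j (by simpa [Nat.lt_succ_iff] using hj)
        simpa using this)
    refine nimComplement_update_ne (c := c) hb (H := update s.heights b y) (k := x)
      (by simpa using hxy) ?_
    simpa using he
  refine wins_left_of_step (.stem b j (hj.trans_lt hh)) ((wins_single c _ a ?_ fun i hi => ?_).1 ?_)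
  · rw [blue_update_zero]
    exact ⟨ha, hab⟩
  · rcases eq_or_ne i b with rfl | hib
    · simp
    · simpa [hib] using hz i hi hib
  · rw [heights_update]
    simpa [hab] using hle

end FlowerState

/-! ### Counting flowers in a flowerbed -/

namespace FlowerState

open NumberGame Function

variable {ι : Type*} {N : ι → Type*} [∀ i, NumberGame (N i)] 

variable {c : PlayConvention} {s : FlowerState N}

theorem blue_restrict_of_mem {X : Set ι} {i : ι} (hi : i ∈ s.blue) (hX : i ∈ X) :
    i ∈ (s.restrict X).blue := by
  simpa [blue, restrict_of_mem hX] using hi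

variable [DecidableEq ι]

/-- The flower `f` is red, has height at least `2`, and is weaker than every blue flower. -/
def IsWeakRed (s : FlowerState N) (f : ι) : Prop :=
  f ∈ s.red ∧ 2 ≤ (s f).1 ∧ ∀ j ∈ s.blue,
    (s j).1 < (s f).1 ∨ ((s j).1 = (s f).1 ∧ 0 < val (s j).2 + val (s f).2)

theorem IsWeakRed.update_zero {f : ι} (h : s.IsWeakRed f) {i : ι} (hi : i ≠ f) (k : ℕ) :
    IsWeakRed (update s i (k, zero)) f := by
  refine ⟨?_, by simpa [hi.symm] using h.2.1, fun j hj => ?_⟩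
  · rw [red_update_zero]
    exact ⟨h.1, hi.symm⟩
  · rw [blue_update_zero] at hj
    have hji : j ≠ i := hj.2
    simpa [hi.symm, hji] using h.2.2 j hj.1

variable [Fintype ι]

theorem wins_left_of_blue_of_red_eq_empty (hr : s.red = ∅) (hb : s.blue.Nonempty) :
    Wins c .left s := by
  obtain ⟨a, ha⟩ := hb
  refine (wins_mono c _ _ (restrict_le (X := {a}) (by simp [hr]))).1
    (wins_single c _ a (blue_restrict_of_mem ha (Set.mem_singleton a)) fun i hi => ?_).2
  rw [restrict_of_notMem (by simpa using hi)]

/-- A majority of blue flowers is winning for Left, moving first with one more blue flower than red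
ones and moving second with two more. -/
theorem wins_of_majority (c : PlayConvention) (s : FlowerState N) :
    (s.red.ncard + 1 ≤ s.blue.ncard → Wins c .left s) ∧
      (s.red.ncard + 2 ≤ s.blue.ncard → ¬ Wins c .right s) := by
  induction hn : size s using Nat.strong_induction_on generalizing s with
  | _ n ih =>
  constructor
  · intro h
    rcases s.red.eq_empty_or_nonempty with hr | ⟨i, hi⟩
    · exact wins_left_of_blue_of_red_eq_empty hr (Set.nonempty_of_ncard_ne_zero (by omega))
    · have hst : Step .left s (update s i (0, zero)) := .stem i 0 hi.1
      refine wins_left_of_step hst ((ih _ (hn ▸ hst.size_lt) _ rfl).2 ?_)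
      have hb : i ∉ s.blue := fun h => lt_asymm h.2 hi.2
      rw [blue_update_zero, red_update_zero, Set.sdiff_singleton_eq_self hb]
      have := Set.ncard_sdiff_singleton_add_one hi
      omega
  · intro h
    obtain ⟨a, ha⟩ : s.blue.Nonempty := Set.nonempty_of_ncard_ne_zero (by omega)
    refine not_wins_right (fun _ => ⟨a, ha.1⟩) fun t ht => ?_
    refine (ih _ (hn ▸ ht.size_lt) _ rfl).1 ?_
    cases ht with
    | stem i k hk =>
      rw [blue_update_zero, red_update_zero]
      have h1 := Set.pred_ncard_le_ncard_sdiff_singleton s.blue i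
      have h2 := Set.ncard_sdiff_singleton_le s.red i
      omega
    | blossom i b _ hb =>
      have h1 := Set.ncard_le_ncard (blue_subset_update hb)
      have h2 := Set.ncard_le_ncard (red_update_subset hb)
      omega

theorem IsWeakRed.wins_left_of_one {f : ι} (h : s.IsWeakRed f) (hr : s.red.ncard = 1)
    (hb : s.blue.ncard = 1) : Wins c .left s := by
  obtain ⟨a, ha⟩ := Set.ncard_eq_one.1 hb
  obtain ⟨g, hg⟩ := Set.ncard_eq_one.1 hr
  obtain rfl : f = g := by simpa [hg] using h.1
  have haB : a ∈ s.blue := by simp [ha]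
  have haf : a ≠ f := by
    rintro rfl
    exact lt_asymm haB.2 h.1.2
  have ea : s.restrict {a, f} a = s a := restrict_of_mem (by simp)
  have ef : s.restrict {a, f} f = s f := restrict_of_mem (by simp)
  have hz : ∀ i, i ≠ a → i ≠ f → (s.restrict {a, f} i).2 = zero := fun i h1 h2 => by
    rw [restrict_of_notMem (by simp [h1, h2])]
  refine (wins_mono c _ _ (restrict_le (X := {a, f}) (by simp [hg]))).1 ?_
  rcases h.2.2 a haB with hlt | ⟨he, hv⟩
  · exact wins_left_of_taller_red (blue_restrict_of_mem haB (by simp)) (by rwa [ea, ef]) hz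
  · exact wins_left_pair haf (by rwa [ea, ef]) (by rw [ea, he]; exact h.2.1) hz (by rwa [ea, ef])

/-- Only cutting a blue stem stops Left from being on move with a blue majority: every other move of
Right keeps all blue flowers and creates no red one. After such a cut the numbers agree and `f` is
intact, which is the case of `ih`. -/
theorem IsWeakRed.not_wins_right {f : ι} (h : s.IsWeakRed f)
    (hrb : s.blue.ncard = s.red.ncard + 1)
    (ih : ∀ t : FlowerState N, t.IsWeakRed f → t.red.ncard = s.red.ncard →
      t.blue.ncard = s.red.ncard → Wins c .left t) : ¬ Wins c .right s := by
  refine FlowerState.not_wins_right (fun _ => ⟨f, h.1.1⟩) fun t ht => ?_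
  cases ht with
  | stem i k hk =>
    by_cases hi : i ∈ s.blue
    · have hr : i ∉ s.red := fun h => lt_asymm h.2 hi.2
      refine ih _ (h.update_zero ?_ k) ?_ ?_
      · rintro rfl
        exact hr h.1
      · rw [red_update_zero, Set.sdiff_singleton_eq_self hr]
      · rw [blue_update_zero]
        have := Set.ncard_sdiff_singleton_add_one hi
        omega
    · refine (wins_of_majority c _).1 ?_
      rw [blue_update_zero, red_update_zero, Set.sdiff_singleton_eq_self hi]
      have := Set.ncard_sdiff_singleton_le s.red i
      omega
  | blossom i b _ hb =>
    refine (wins_of_majority c _).1 ?_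
    have h1 := Set.ncard_le_ncard (blue_subset_update hb)
    have h2 := Set.ncard_le_ncard (red_update_subset hb)
    omega

/-- Cutting down a red flower other than `f` leaves Right without a winning move. -/
theorem IsWeakRed.not_wins_right_update {f : ι} (h : s.IsWeakRed f)
    (hrb : s.red.ncard = s.blue.ncard) {g : ι} (hg : g ∈ s.red) (hgf : g ≠ f)
    (ih : ∀ t : FlowerState N, t.IsWeakRed f → t.red.ncard + 1 = s.red.ncard →
      t.blue.ncard + 1 = s.red.ncard → Wins c .left t) :
    ¬ Wins c .right (update s g (0, zero)) := by
  have hgb : g ∉ s.blue := fun h => lt_asymm h.2 hg.2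
  have hr : (red (update s g (0, zero))).ncard + 1 = s.red.ncard := by
    rw [red_update_zero]
    exact Set.ncard_sdiff_singleton_add_one hg
  have hb : (blue (update s g (0, zero))).ncard = s.blue.ncard := by
    rw [blue_update_zero, Set.sdiff_singleton_eq_self hgb]
  exact (h.update_zero hgf 0).not_wins_right (by omega)
    fun t ht h1 h2 => ih t ht (by omega) (by omega)

theorem IsWeakRed.wins_left {f : ι} (h : s.IsWeakRed f) (hrb : s.red.ncard = s.blue.ncard) :
    Wins c .left s := by
  induction hn : s.red.ncard generalizing s with
  | zero =>
    rw [Set.ncard_eq_zero] at hn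
    exact absurd h.1 (by simp [hn])
  | succ n ih =>
    rcases n.eq_zero_or_pos with rfl | hn0
    · exact h.wins_left_of_one hn (by omega)
    · obtain ⟨g, hg, hgf⟩ := Set.exists_ne_of_one_lt_ncard (s := s.red) (by omega) f
      exact wins_left_of_step (.stem g 0 hg.1) (h.not_wins_right_update hrb hg hgf
        fun t ht h1 h2 => ih ht (by omega) (by omega))

/-- With at least two red flowers, one move wins under both conventions. -/
theorem IsWeakRed.exists_step {f : ι} (h : s.IsWeakRed f) (hrb : s.red.ncard = s.blue.ncard)
    (h2 : 2 ≤ s.red.ncard) : ∃ t, Step .left s t ∧ ∀ c, ¬ Wins c .right t := by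
  obtain ⟨g, hg, hgf⟩ := Set.exists_ne_of_one_lt_ncard h2 f
  exact ⟨_, .stem g 0 hg.1, fun c => h.not_wins_right_update hrb hg hgf
    fun t ht h1 h2 => ht.wins_left (by omega)⟩

end FlowerState

/-! ### Pruning in disjoint sums and on stems -/

namespace Hackenbush

theorem canCut_green (p : Player) : p.CanCut EdgeColor.green := by
  cases p <;> exact fun h => EdgeColor.noConfusion h

section Sum

variable {ι : Type} [Finite ι] {G : ι → Hackenbush.{u}}

theorem grounded_sum {S : Set (sum G).E} {i : ι} {v : (G i).V} :
    (sum G).Grounded S ⟨i, v⟩ ↔ (G i).Grounded {e | (⟨i, e⟩ : Σ i, (G i).E) ∈ S} v := by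
  constructor
  · suffices h : ∀ w : (sum G).V, (sum G).Grounded S w →
        (G w.1).Grounded {e | (⟨w.1, e⟩ : Σ i, (G i).E) ∈ S} w.2 from h ⟨i, v⟩
    intro w hw
    induction hw with
    | base w hw => exact .base _ hw
    | step e w w' he hw hw' _ ih =>
      obtain ⟨j, e⟩ := e
      obtain ⟨x, hx, rfl⟩ := Sym2.mem_map.1 hw
      obtain ⟨x', hx', rfl⟩ := Sym2.mem_map.1 hw'
      exact .step e x x' he hx hx' ih
  · intro h
    induction h with
    | base v hv => exact .base _ hv
    | step e v w he hv hw _ ih =>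
      exact .step (G := sum G) ⟨i, e⟩ ⟨i, v⟩ ⟨i, w⟩ he (Sym2.mem_map.2 ⟨v, hv, rfl⟩)
        (Sym2.mem_map.2 ⟨w, hw, rfl⟩) ih

theorem mem_prune_sum {S : Set (sum G).E} {i : ι} {e : (G i).E} :
    (⟨i, e⟩ : Σ i, (G i).E) ∈ (sum G).prune S ↔
      e ∈ (G i).prune {e | (⟨i, e⟩ : Σ i, (G i).E) ∈ S} := by
  refine and_congr_right fun _ => ?_
  constructor
  · rintro ⟨v, hv, hg⟩
    obtain ⟨x, hx, rfl⟩ := Sym2.mem_map.1 hv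
    exact ⟨x, hx, grounded_sum.1 hg⟩
  · rintro ⟨v, hv, hg⟩
    exact ⟨⟨i, v⟩, Sym2.mem_map.2 ⟨v, hv, rfl⟩, grounded_sum.2 hg⟩

end Sum

section OnStem

variable {h : ℕ} {B : Hackenbush.{u}} {S : Set (onStem h B).E}

open Classical in
/-- The vertex of `onStem h B` that corresponds to a vertex of `B`. -/
noncomputable def stemVertex (h : ℕ) (B : Hackenbush.{u}) (v : B.V) : Fin (h + 1) ⊕ B.V :=
  if v ∈ B.ground then Sum.inl (Fin.last h) else Sum.inr v

theorem stemVertex_of_mem {v : B.V} (hv : v ∈ B.ground) :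
    stemVertex h B v = Sum.inl (Fin.last h) := if_pos hv

theorem stemVertex_of_notMem {v : B.V} (hv : v ∉ B.ground) :
    stemVertex h B v = Sum.inr v := if_neg hv

theorem mem_ends_inl {k : Fin h} {v : Fin (h + 1) ⊕ B.V} :
    v ∈ (onStem h B).ends (.inl k) ↔ v = .inl k.castSucc ∨ v = .inl k.succ := Sym2.mem_iff

theorem mem_ends_inr {e : B.E} {v : Fin (h + 1) ⊕ B.V} :
    v ∈ (onStem h B).ends (.inr e) ↔ ∃ x ∈ B.ends e, stemVertex h B x = v := Sym2.mem_map

/-- The vertices of `onStem h B` that are joined to the ground. -/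
def StemGrounded (S : Set (onStem h B).E) : Fin (h + 1) ⊕ B.V → Prop
  | .inl v => ∀ k : Fin h, k.castSucc < v → (.inl k : Fin h ⊕ B.E) ∈ S
  | .inr v => (∀ k : Fin h, (.inl k : Fin h ⊕ B.E) ∈ S) ∧
      B.Grounded {e | (.inr e : Fin h ⊕ B.E) ∈ S} v

theorem stemGrounded_stemVertex {v : B.V} : StemGrounded S (stemVertex h B v) ↔
    (∀ k : Fin h, (.inl k : Fin h ⊕ B.E) ∈ S) ∧
      B.Grounded {e | (.inr e : Fin h ⊕ B.E) ∈ S} v := by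
  by_cases hv : v ∈ B.ground
  · rw [stemVertex_of_mem hv]
    exact ⟨fun hS => ⟨fun k => hS k k.castSucc_lt_last, .base v hv⟩, fun hS k _ => hS.1 k⟩
  · rw [stemVertex_of_notMem hv]
    rfl

theorem stemGrounded_of_grounded {v : (onStem h B).V} (hv : (onStem h B).Grounded S v) :
    StemGrounded S v := by
  induction hv with
  | base v hv =>
    obtain rfl : v = (.inl 0 : Fin (h + 1) ⊕ B.V) := hv
    exact fun k hk => absurd hk (Fin.not_lt_zero _)
  | step e v w he hv hw _ ih =>
    rcases e with k | e
    · have hk : ∀ j : Fin h, j < k → (.inl j : Fin h ⊕ B.E) ∈ S := by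
        rcases mem_ends_inl.1 hv with rfl | rfl
        · exact fun j hj => ih j (Fin.castSucc_lt_castSucc_iff.2 hj)
        · exact fun j hj => ih j ((Fin.castSucc_lt_castSucc_iff.2 hj).trans k.castSucc_lt_succ)
      rcases mem_ends_inl.1 hw with rfl | rfl
      · exact fun j hj => hk j (Fin.castSucc_lt_castSucc_iff.1 hj)
      · intro j hj
        rcases (Fin.castSucc_lt_succ_iff.1 hj).lt_or_eq with hj | rfl
        · exact hk j hj
        · exact he
    · obtain ⟨x, hx, rfl⟩ := mem_ends_inr.1 hv
      obtain ⟨y, hy, rfl⟩ := mem_ends_inr.1 hw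
      rw [stemGrounded_stemVertex] at ih ⊢
      exact ⟨ih.1, .step e x y he hx hy ih.2⟩

theorem grounded_inl {v : Fin (h + 1)}
    (hv : ∀ k : Fin h, k.castSucc < v → (.inl k : Fin h ⊕ B.E) ∈ S) :
    (onStem h B).Grounded S (.inl v) := by
  induction v using Fin.induction with
  | zero => exact .base _ rfl
  | succ k ih =>
    exact .step (G := onStem h B) (.inl k) (.inl k.castSucc) (.inl k.succ)
      (hv k k.castSucc_lt_succ) (mem_ends_inl.2 (.inl rfl)) (mem_ends_inl.2 (.inr rfl))
      (ih fun j hj => hv j (hj.trans k.castSucc_lt_succ))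

theorem grounded_stemVertex (hS : ∀ k : Fin h, (.inl k : Fin h ⊕ B.E) ∈ S) {v : B.V}
    (hv : B.Grounded {e | (.inr e : Fin h ⊕ B.E) ∈ S} v) :
    (onStem h B).Grounded S (stemVertex h B v) := by
  induction hv with
  | base v hv =>
    rw [stemVertex_of_mem hv]
    exact grounded_inl fun k _ => hS k
  | step e v w he hv hw _ ih =>
    exact .step (G := onStem h B) (.inr e) _ _ he (mem_ends_inr.2 ⟨v, hv, rfl⟩)
      (mem_ends_inr.2 ⟨w, hw, rfl⟩) ih

theorem inl_mem_prune {k : Fin h} : (.inl k : Fin h ⊕ B.E) ∈ (onStem h B).prune S ↔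
    ∀ j ≤ k, (.inl j : Fin h ⊕ B.E) ∈ S := by
  constructor
  · rintro ⟨hk, v, hv, hg⟩ j hj
    rcases hj.lt_or_eq with hj | rfl
    · rcases mem_ends_inl.1 hv with rfl | rfl
      · exact stemGrounded_of_grounded hg j (Fin.castSucc_lt_castSucc_iff.2 hj)
      · exact stemGrounded_of_grounded hg j
          ((Fin.castSucc_lt_castSucc_iff.2 hj).trans k.castSucc_lt_succ)
    · exact hk
  · intro hS
    exact ⟨hS k le_rfl, _, mem_ends_inl.2 (.inl rfl),
      grounded_inl fun j hj => hS j (Fin.castSucc_lt_castSucc_iff.1 hj).le⟩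

theorem inr_mem_prune {e : B.E} : (.inr e : Fin h ⊕ B.E) ∈ (onStem h B).prune S ↔
    (∀ k : Fin h, (.inl k : Fin h ⊕ B.E) ∈ S) ∧
      e ∈ B.prune {e | (.inr e : Fin h ⊕ B.E) ∈ S} := by
  constructor
  · rintro ⟨he, v, hv, hg⟩
    obtain ⟨x, hx, rfl⟩ := mem_ends_inr.1 hv
    have := stemGrounded_stemVertex.1 (stemGrounded_of_grounded hg)
    exact ⟨this.1, he, x, hx, this.2⟩
  · rintro ⟨hS, he, x, hx, hg⟩
    exact ⟨he, _, mem_ends_inr.2 ⟨x, hx, rfl⟩, grounded_stemVertex hS hg⟩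

end OnStem

end Hackenbush

/-! ### Identifying graph positions with abstract ones -/

open Hackenbush

/-- The positions in the play on the blossom alone. -/
def GenFlower.BlossomPos (F : GenFlower.{u}) : Type u :=
  {S : Set F.blossom.E // F.blossom.prune S = S}

/-- Only pruned edge sets are admitted as positions, because the number property was shown for
these. -/
noncomputable instance (F : GenFlower.{u}) : NumberGame F.BlossomPos where
  Move p a b := ∃ e, F.blossom.Legal p a.1 e ∧ b.1 = F.blossom.cut a.1 e
  val a := F.blossom.posValue a.1
  size a := a.1.ncard
  zero := ⟨∅, prune_empty⟩
  size_lt := by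
    rintro p a b ⟨e, he, hb⟩
    rw [hb]
    exact F.blossom.ncard_cut_lt he.1
  val_isSimplest a := by
    have h : ∀ p, F.blossom.optionValues p a.1 = {x | ∃ b : F.BlossomPos,
        (∃ e, F.blossom.Legal p a.1 e ∧ b.1 = F.blossom.cut a.1 e) ∧
          x = F.blossom.posValue b.1} := by
      intro p
      ext x
      constructor
      · rintro ⟨e, he, rfl⟩
        exact ⟨⟨_, prune_cut a.1 e⟩, ⟨e, he, rfl⟩, rfl⟩
      · rintro ⟨b, ⟨e, he, hb⟩, rfl⟩
        exact ⟨e, he, by rw [hb]⟩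
    have := isSimplestBetween_posValue F.redBlue a.2
    rwa [h, h] at this
  not_move_zero := by
    rintro p a ⟨e, he, -⟩
    exact he.1
  size_zero := Set.ncard_empty _

namespace flowerSum

open NumberGame Function

variable {ι : Type} {F : ι → GenFlower.{u}} {s : FlowerState fun i => (F i).BlossomPos}

/-- Stems have not grown, and a stem that has been cut carries no blossom. -/
def Valid (s : FlowerState fun i => (F i).BlossomPos) : Prop :=
  ∀ i, (s i).1 ≤ (F i).height ∧ ((s i).1 < (F i).height → (s i).2 = zero)

/-- This is the use of `Valid`: a blossom edge that is still present certifies an uncut stem, as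
pruning in the graph demands. -/
theorem Valid.height_eq (hs : Valid s) {i : ι} {e : (F i).blossom.E} (he : e ∈ (s i).2.1) :
    (s i).1 = (F i).height := by
  refine (hs i).1.eq_of_not_lt fun h => ?_
  rw [(hs i).2 h] at he
  exact he

theorem Valid.step [DecidableEq ι] (hs : Valid s) {p : Player} {t : FlowerState fun i => (F i).BlossomPos}
    (hst : FlowerState.Step p s t) : Valid t := by
  intro j
  cases hst with
  | stem i k hk =>
    rcases eq_or_ne j i with rfl | hj
    · simpa using hk.le.trans (hs j).1
    · simpa [hj] using hs j
  | blossom i b h0 hb =>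
    rcases eq_or_ne j i with rfl | hj
    · obtain ⟨e, he, -⟩ := hb
      simp [hs.height_eq he.1]
    · simpa [hj] using hs j

variable (F) in
/-- The initial state. -/
def initial : FlowerState fun i => (F i).BlossomPos :=
  fun i => ((F i).height, ⟨(F i).blossom.start, prune_prune _⟩)

theorem valid_initial : Valid (initial F) := fun _ => ⟨le_rfl, fun h => absurd h (lt_irrefl _)⟩

theorem blue_initial : (initial F).blue = {i | (F i).IsBlue} :=
  Set.ext fun i => and_iff_right (F i).height_pos

theorem red_initial : (initial F).red = {i | (F i).IsRed} :=
  Set.ext fun i => and_iff_right (F i).height_pos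

/-- A weakest flower is at least as tall as every red or blue one, hence has height at least 2.
Against a blue flower of equal height its value is no larger in modulus, and absence of cancellation
makes this strict, so the sum is positive. -/
theorem isWeakRed_initial (hcancel : ∀ i j, ¬ (F i).Cancel (F j)) {i f : ι}
    (hi : (F i).IsBlue ∨ (F i).IsRed) (h2 : 2 ≤ (F i).height) (hf : (F f).IsRed)
    (hweak : ∀ j, (F j).IsBlue ∨ (F j).IsRed → ¬ (F j).Weaker (F f)) :
    (initial F).IsWeakRed f := by
  refine ⟨red_initial.symm ▸ hf, ?_, fun j hj => ?_⟩
  · have := hweak i hi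
    simp only [GenFlower.Weaker, not_or, not_lt] at this
    exact h2.trans this.1
  · have hjb : (F j).IsBlue := by rwa [blue_initial] at hj
    have hw := hweak j (.inl hjb)
    have hc := hcancel j f
    simp only [GenFlower.Weaker, not_or, not_lt, not_and] at hw
    rcases hw.1.lt_or_eq with hlt | he
    · exact .inl hlt
    · refine .inr ⟨he, ?_⟩
      have h1 := hw.2 he
      rw [abs_of_neg hf, abs_of_pos hjb] at h1
      have h3 : (F j).blossomValue ≠ -(F f).blossomValue := fun h => hc ⟨hjb, hf, he, h⟩
      have h4 : -(F f).blossomValue < (F j).blossomValue := lt_of_le_of_ne h1 h3.symm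
      change 0 < (F j).blossomValue + (F f).blossomValue
      linarith

variable [Finite ι]

/-- The edges of the stem of a flower, as edges of the sum. -/
def stemEdge (F : ι → GenFlower.{u}) (i : ι) (k : Fin (F i).height) : (flowerSum F).E :=
  (⟨i, .inl k⟩ : Σ i, (F i).graph.E)

/-- The edges of the blossom of a flower, as edges of the sum. -/
def blossomEdge (F : ι → GenFlower.{u}) (i : ι) (e : (F i).blossom.E) : (flowerSum F).E :=
  (⟨i, .inr e⟩ : Σ i, (F i).graph.E)

theorem edge_cases {P : (flowerSum F).E → Prop} (h1 : ∀ i k, P (stemEdge F i k))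
    (h2 : ∀ i e, P (blossomEdge F i e)) (e : (flowerSum F).E) : P e := by
  obtain ⟨i, k | e⟩ := e
  · exact h1 i k
  · exact h2 i e

theorem stemEdge_mem_prune {S : Set (flowerSum F).E} {i : ι} {k : Fin (F i).height} :
    stemEdge F i k ∈ (flowerSum F).prune S ↔ ∀ j ≤ k, stemEdge F i j ∈ S :=
  mem_prune_sum.trans inl_mem_prune

theorem blossomEdge_mem_prune {S : Set (flowerSum F).E} {i : ι} {e : (F i).blossom.E} :
    blossomEdge F i e ∈ (flowerSum F).prune S ↔
      (∀ k, stemEdge F i k ∈ S) ∧ e ∈ (F i).blossom.prune {e | blossomEdge F i e ∈ S} :=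
  mem_prune_sum.trans inr_mem_prune

theorem stemEdge_inj {i j : ι} {k : Fin (F i).height} {l : Fin (F j).height} :
    stemEdge F i k = stemEdge F j l ↔ i = j ∧ (k : ℕ) = l := by
  constructor
  · intro h
    obtain ⟨rfl, h⟩ := Sigma.mk.inj h
    exact ⟨rfl, congrArg Fin.val (Sum.inl_injective (eq_of_heq h))⟩
  · rintro ⟨rfl, h⟩
    rw [Fin.ext h]

theorem blossomEdge_inj {i : ι} {e f : (F i).blossom.E} :
    blossomEdge F i e = blossomEdge F i f ↔ e = f := by
  refine ⟨fun h => ?_, fun h => h ▸ rfl⟩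
  exact Sum.inr_injective (eq_of_heq (Sigma.mk.inj h).2)

theorem blossomEdge_ne {i j : ι} (hij : i ≠ j) {e : (F i).blossom.E} {f : (F j).blossom.E} :
    blossomEdge F i e ≠ blossomEdge F j f := fun h => hij (Sigma.mk.inj h).1

theorem stemEdge_ne_blossomEdge {i j : ι} {k : Fin (F i).height} {f : (F j).blossom.E} :
    stemEdge F i k ≠ blossomEdge F j f := by
  intro h
  obtain ⟨rfl, h⟩ := Sigma.mk.inj h
  exact Sum.inl_ne_inr (eq_of_heq h)

/-- The edges that are present in a given state of the flowers. -/
def edgeSet (s : FlowerState fun i => (F i).BlossomPos) : Set (flowerSum F).E :=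
  {e | match (e : Σ i, Fin (F i).height ⊕ (F i).blossom.E) with
    | ⟨i, .inl k⟩ => (k : ℕ) < (s i).1
    | ⟨i, .inr e⟩ => e ∈ (s i).2.1}

theorem stemEdge_mem_edgeSet {i : ι} {k : Fin (F i).height} :
    stemEdge F i k ∈ edgeSet s ↔ (k : ℕ) < (s i).1 := Iff.rfl

theorem blossomEdge_mem_edgeSet {i : ι} {e : (F i).blossom.E} :
    blossomEdge F i e ∈ edgeSet s ↔ e ∈ (s i).2.1 := Iff.rfl

theorem edgeSet_ext {S : Set (flowerSum F).E}
    (h1 : ∀ i k, stemEdge F i k ∈ S ↔ (k : ℕ) < (s i).1)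
    (h2 : ∀ i e, blossomEdge F i e ∈ S ↔ e ∈ (s i).2.1) : S = edgeSet s :=
  Set.ext (edge_cases h1 h2)

theorem start_eq : (flowerSum F).start = edgeSet (initial F) := by
  refine edgeSet_ext (fun i k => ?_) fun i e => ?_
  · rw [start, stemEdge_mem_prune]
    exact ⟨fun _ => k.2, fun _ _ _ => trivial⟩
  · rw [start, blossomEdge_mem_prune]
    exact ⟨fun h => h.2, fun h => ⟨fun _ => trivial, h⟩⟩

variable [DecidableEq ι]

theorem cut_stemEdge (hs : Valid s) {i : ι} {k : Fin (F i).height} (hk : (k : ℕ) < (s i).1) :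
    (flowerSum F).cut (edgeSet s) (stemEdge F i k) = edgeSet (update s i ((k : ℕ), zero)) := by
  refine edgeSet_ext (fun j l => ?_) fun j e => ?_
  · rw [cut, stemEdge_mem_prune]
    simp only [Set.mem_sdiff, Set.mem_singleton_iff, stemEdge_mem_edgeSet, stemEdge_inj]
    rcases eq_or_ne j i with rfl | hj
    · simp only [update_self, true_and]
      constructor
      · intro h
        by_contra! hlt
        exact (h k hlt).2 rfl
      · intro h m hm
        have : (m : ℕ) ≤ l := hm
        omega
    · simp only [update_of_ne hj, hj, false_and, not_false_eq_true, and_true]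
      refine ⟨fun h => h l le_rfl, fun h m hm => ?_⟩
      have : (m : ℕ) ≤ l := hm
      omega
  · rw [cut, blossomEdge_mem_prune]
    simp only [Set.mem_sdiff, Set.mem_singleton_iff, stemEdge_mem_edgeSet, stemEdge_inj,
      blossomEdge_mem_edgeSet, stemEdge_ne_blossomEdge.symm, not_false_eq_true, and_true,
      Set.ofPred_mem_eq, (s j).2.2]
    rcases eq_or_ne j i with rfl | hj
    · simp only [update_self, true_and]
      exact ⟨fun h => absurd rfl (h.1 k).2, fun h => h.elim⟩
    · simp only [update_of_ne hj, hj, false_and, not_false_eq_true, and_true]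
      exact ⟨fun h => h.2, fun h => ⟨fun m => m.2.trans_eq (hs.height_eq h).symm, h⟩⟩

theorem cut_blossomEdge (hs : Valid s) {i : ι} {e : (F i).blossom.E} (he : e ∈ (s i).2.1)
    (b : (F i).BlossomPos) (hb : b.1 = (F i).blossom.cut (s i).2.1 e) :
    (flowerSum F).cut (edgeSet s) (blossomEdge F i e) = edgeSet (update s i ((s i).1, b)) := by
  refine edgeSet_ext (fun j l => ?_) fun j f => ?_
  · rw [cut, stemEdge_mem_prune]
    simp only [Set.mem_sdiff, Set.mem_singleton_iff, stemEdge_mem_edgeSet, stemEdge_ne_blossomEdge,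
      not_false_eq_true, and_true]
    have hj : (update s i ((s i).1, b) j).1 = (s j).1 := by
      rcases eq_or_ne j i with rfl | hj
      · simp
      · simp [hj]
    rw [hj]
    refine ⟨fun h => h l le_rfl, fun h m hm => ?_⟩
    have : (m : ℕ) ≤ l := hm
    omega
  · rw [cut, blossomEdge_mem_prune]
    simp only [Set.mem_sdiff, Set.mem_singleton_iff, stemEdge_mem_edgeSet, stemEdge_ne_blossomEdge,
      blossomEdge_mem_edgeSet, not_false_eq_true, and_true]
    rcases eq_or_ne j i with rfl | hj
    · simp only [blossomEdge_inj, update_self, hb]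
      exact ⟨fun h => h.2, fun h => ⟨fun m => m.2.trans_eq (hs.height_eq he).symm, h⟩⟩
    · simp only [blossomEdge_ne hj, update_of_ne hj, not_false_eq_true, and_true,
        Set.ofPred_mem_eq, (s j).2.2]
      exact ⟨fun h => h.2, fun h => ⟨fun m => m.2.trans_eq (hs.height_eq h).symm, h⟩⟩

theorem exists_step_of_legal (hs : Valid s) {p : Player} {e : (flowerSum F).E}
    (he : (flowerSum F).Legal p (edgeSet s) e) :
    ∃ t, FlowerState.Step p s t ∧ (flowerSum F).cut (edgeSet s) e = edgeSet t := by
  induction e using edge_cases with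
  | h1 i k => exact ⟨_, .stem i k he.1, cut_stemEdge hs he.1⟩
  | h2 i e =>
    have h0 : 0 < (s i).1 := by
      rw [hs.height_eq he.1]
      exact (F i).height_pos
    exact ⟨_, .blossom i ⟨_, prune_cut (s i).2.1 e⟩ h0 ⟨e, ⟨he.1, he.2⟩, rfl⟩,
      cut_blossomEdge hs he.1 _ rfl⟩

theorem exists_legal_of_step (hs : Valid s) {p : Player}
    {t : FlowerState fun i => (F i).BlossomPos} (hst : FlowerState.Step p s t) :
    ∃ e, (flowerSum F).Legal p (edgeSet s) e ∧ (flowerSum F).cut (edgeSet s) e = edgeSet t := by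
  cases hst with
  | stem i k hk =>
    exact ⟨stemEdge F i ⟨k, hk.trans_le (hs i).1⟩, ⟨hk, canCut_green p⟩, cut_stemEdge hs hk⟩
  | blossom i b h0 hb =>
    obtain ⟨e, he, hb⟩ := hb
    exact ⟨blossomEdge F i e, ⟨he.1, he.2⟩, cut_blossomEdge hs he.1 b hb⟩

theorem nextWins_edgeSet [Fintype ι] (c : PlayConvention) (p : Player) (hs : Valid s) :
    (flowerSum F).NextWins c p (edgeSet s) ↔ FlowerState.Wins c p s := by
  induction hn : FlowerState.size s using Nat.strong_induction_on generalizing s p with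
  | _ n ih =>
  rw [NextWins, FlowerState.Wins]
  refine or_congr (and_congr_right fun _ => ?_) ?_
  · constructor
    · intro h t ht
      obtain ⟨e, he, -⟩ := exists_legal_of_step hs ht
      exact h e he
    · intro h e he
      obtain ⟨t, ht, -⟩ := exists_step_of_legal hs he
      exact h t ht
  · constructor
    · rintro ⟨e, he, h⟩
      obtain ⟨t, ht, het⟩ := exists_step_of_legal hs he
      rw [het, ih _ (hn ▸ ht.size_lt) _ (hs.step ht) rfl] at h
      exact ⟨t, ht, h⟩
    · rintro ⟨t, ht, h⟩
      obtain ⟨e, he, het⟩ := exists_legal_of_step hs ht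
      refine ⟨e, he, ?_⟩
      rwa [het, ih _ (hn ▸ ht.size_lt) _ (hs.step ht) rfl]

/-- A winning step from the initial state is a winning move in the graph. -/
theorem exists_winningMove [Fintype ι] {t : FlowerState fun i => (F i).BlossomPos}
    (ht : FlowerState.Step .left (initial F) t) :
    ∃ e, ∀ c, ¬ FlowerState.Wins c .right t →
      (flowerSum F).WinningMove c .left (flowerSum F).start e := by
  obtain ⟨e, he, het⟩ := exists_legal_of_step valid_initial ht
  refine ⟨e, fun c hc => ?_⟩
  rw [start_eq]
  exact ⟨he, by rwa [het, nextWins_edgeSet c _ (valid_initial.step ht)]⟩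

end flowerSum

/-- A misère win may consist in having no move; a standing stem excludes this, so an actual winning
move exists. -/
theorem FlowerState.Wins.exists_step_left {ι : Type*} {N : ι → Type*} [∀ i, NumberGame (N i)]
    [DecidableEq ι] [Fintype ι] {c : PlayConvention} {s : FlowerState N} (h : Wins c .left s)
    (hs : ∃ i, 0 < (s i).1) : ∃ t, Step .left s t ∧ ¬ Wins c .right t := by
  rw [Wins] at h
  rcases h with ⟨-, h⟩ | ⟨t, ht, h⟩
  · obtain ⟨i, hi⟩ := hs
    exact absurd (.stem i 0 hi) (h _)
  · exact ⟨t, ht, h⟩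

theorem theorem4p10 {ι : Type} [Finite ι] (F : ι → GenFlower.{u}) (n : ℕ)
    (hbed : IsFlowerbed F n)
    -- some red or blue Generalized Flower has height at least 2
    (htall : ∃ i, ((F i).IsBlue ∨ (F i).IsRed) ∧ 2 ≤ (F i).height)
    (hcancel : ∀ i j, ¬ (F i).Cancel (F j))
    -- the weakest among the red and blue Generalized Flowers is red
    (hweak : ∃ i, (F i).IsRed ∧
      ∀ j, (F j).IsBlue ∨ (F j).IsRed → ¬ (F j).Weaker (F i)) :
    (∀ c : PlayConvention, ∃ e,
      (flowerSum F).WinningMove c Player.left (flowerSum F).start e) ∧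
    (2 ≤ n → ∃ e, ∀ c : PlayConvention,
      (flowerSum F).WinningMove c Player.left (flowerSum F).start e) := by
  classical
  have := Fintype.ofFinite ι
  obtain ⟨i, hi, h2⟩ := htall
  obtain ⟨f, hf, hweak⟩ := hweak
  have hwr := flowerSum.isWeakRed_initial hcancel hi h2 hf hweak
  have hb : (flowerSum.initial F).blue.ncard = n := by rw [flowerSum.blue_initial]; exact hbed.1
  have hr : (flowerSum.initial F).red.ncard = n := by rw [flowerSum.red_initial]; exact hbed.2
  constructor
  · intro c
    obtain ⟨t, ht, hc⟩ :=
      (hwr.wins_left (c := c) (hr.trans hb.symm)).exists_step_left ⟨f, hwr.1.1⟩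
    obtain ⟨e, he⟩ := flowerSum.exists_winningMove ht
    exact ⟨e, he c hc⟩
  · intro hn
    obtain ⟨t, ht, hc⟩ := hwr.exists_step (hr.trans hb.symm) (hr ▸ hn)
    obtain ⟨e, he⟩ := flowerSum.exists_winningMove ht
    exact ⟨e, fun c => he c (hc c)⟩
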